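/- For $0<p<\infty$ let $H^p(\mathbb D)$ be the Hardy space of holomorphic functions $f$ on the unit disc $\mathbb D$ with $\|f\|_{H^p}^p=\sup_{0<r<1}\int_{\mathbb T}|f(r\zeta)|^p\,dm(\zeta)<\infty$, where $m$ is the normalized Lebesgue measure on the unit circle $\mathbb T$. For $0<p_0,p_1<\infty$, $0<\theta<1$ and $0<q\le\infty$ let $(H^{p_0}(\mathbb D),H^{p_1}(\mathbb D))_{\theta,q}$ be the real interpolation space of all $f\in H^{p_0}(\mathbb D)+H^{p_1}(\mathbb D)$ with $$\|f\|_{\theta,q}=\Big(\int_0^\infty\big(t^{-\theta}K(t,f)\big)^q\,\frac{dt}{t}\Big)^{1/q}<\infty$$ (for $q=\infty$: $\|f\|_{\theta,\infty}=\sup_{t>0}t^{-\theta}K(t,f)<\infty$), where $$K(t,f)=\inf\{\|f_0\|_{H^{p_0}}+t\|f_1\|_{H^{p_1}} : f=f_0+f_1,\ f_0\in H^{p_0}(\mathbb D),\ f_1\in H^{p_1}(\mathbb D)\}.$$ Let $0<p_0,p_1<\infty$ and let $T$ be a linear operator on $H^{p_0}(\mathbb D)+H^{p_1}(\mathbb D)$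 which maps $H^{p_j}(\mathbb D)$ boundedly into $H^{p_j}(\mathbb D)$ for $j=0,1$, and such that $T:H^{p_1}(\mathbb D)\to H^{p_1}(\mathbb D)$ is compact. Then, for all $0<\theta<1$ and $0<q\le\infty$, $T$ maps $(H^{p_0}(\mathbb D),H^{p_1}(\mathbb D))_{\theta,q}$ into itself, and $$T:(H^{p_0}(\mathbb D),H^{p_1}(\mathbb D))_{\theta,q}\to(H^{p_0}(\mathbb D),H^{p_1}(\mathbb D))_{\theta,q}$$ is a compact operator. -/

import Mathlib

open Set MeasureTheory Complex
open scoped ENNReal NNReal Topology Uniformity Complex.UnitDisc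

noncomputable section

/-! ### Quasi-normed spaces inside an ambient vector space -/

section Quasi

variable {V : Type*} [AddCommGroup V] [Module ℂ V]

/-- A homogeneous functional `V → [0, ∞]` satisfying the triangle inequality up to a constant. It
describes the quasi-normed space `{x | N x < ∞}` lying in the ambient vector space `V`. (That
`N x = 0` only for `x = 0` is not part of the data; it holds for the Hardy spaces and for their
interpolation spaces.) -/
structure ExtQuasiNorm (V : Type*) [AddCommGroup V] [Module ℂ V] where
  toFun : V → ℝ≥0∞
  map_smul' : ∀ (c : ℂ) (x : V), toFun (c • x) = ‖c‖ₑ * toFun x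
  add_le' : ∃ C : ℝ≥0, ∀ x y : V, toFun (x + y) ≤ C * (toFun x + toFun y)

namespace ExtQuasiNorm

instance : CoeFun (ExtQuasiNorm V) (fun _ => V → ℝ≥0∞) := ⟨toFun⟩

variable (N A₀ A₁ : ExtQuasiNorm V)

theorem map_smul (c : ℂ) (x : V) : N (c • x) = ‖c‖ₑ * N x := N.map_smul' c x

theorem map_zero : N 0 = 0 := by
  simpa using N.map_smul 0 0

theorem map_neg (x : V) : N (-x) = N x := by
  simpa using N.map_smul (-1) x

theorem map_sub_rev (x y : V) : N (x - y) = N (y - x) := by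
  rw [← N.map_neg, neg_sub]

/-- The vector space `{x | N x < ∞}`. -/
def space : Submodule ℂ V where
  carrier := {x | N x < ∞}
  add_mem' := by
    intro x y hx hy
    obtain ⟨C, hC⟩ := N.add_le'
    exact (hC x y).trans_lt (ENNReal.mul_lt_top ENNReal.coe_lt_top (ENNReal.add_lt_top.2 ⟨hx, hy⟩))
  zero_mem' := by simp [N.map_zero]
  smul_mem' := by
    intro c x hx
    simp only [mem_ofPred_eq, N.map_smul] at hx ⊢
    exact ENNReal.mul_lt_top enorm_lt_top hx

/-- The space `{x | N x < ∞}` as a type of its own, which carries the topology given by the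
quasi-norm and not a topology inherited from `V`. -/
def Space : Type _ := N.space

instance : AddCommGroup N.Space := inferInstanceAs (AddCommGroup N.space)

instance : Module ℂ N.Space := inferInstanceAs (Module ℂ N.space)

/-- The quasi-norm topology: the uniform structure in which `{(x, y) | N (x - y) < ε}`, `ε > 0`,
is a basis of entourages. -/
instance : UniformSpace N.Space :=
  UniformSpace.ofCore
    { uniformity := ⨅ ε > (0 : ℝ≥0∞),
        Filter.principal {z : N.Space × N.Space | N (z.1.1 - z.2.1) < ε}
      refl := le_iInf₂ fun ε hε => Filter.principal_mono.2 <| by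
        rintro ⟨x, y⟩ hxy
        obtain rfl : x = y := by simpa using hxy
        simpa [N.map_zero] using hε
      symm := Filter.tendsto_iInf_iInf fun ε => Filter.tendsto_iInf_iInf fun _ =>
        Filter.tendsto_principal_principal.2 fun z hz => by
          simp only [mem_ofPred_eq, Prod.fst_swap, Prod.snd_swap] at hz ⊢
          rwa [N.map_sub_rev]
      comp := le_iInf₂ fun ε hε => by
        obtain ⟨C, hC⟩ := N.add_le'
        obtain ⟨δ, hδ, hδε⟩ : ∃ δ : ℝ≥0∞, 0 < δ ∧ (C : ℝ≥0∞) * (δ + δ) ≤ ε := by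
          rcases eq_or_ne ε ∞ with rfl | hε'
          · exact ⟨1, one_pos, le_top⟩
          · refine ⟨ε / (2 * (C + 1)), ENNReal.div_pos hε.ne' (by finiteness), ?_⟩
            rw [← two_mul, ← mul_assoc, ← mul_div_assoc]
            refine ENNReal.div_le_of_le_mul ?_
            rw [mul_comm ε]
            refine mul_le_mul_left ?_ ε
            rw [mul_comm]
            exact mul_le_mul_right le_self_add 2
        refine Filter.le_principal_iff.2 (Filter.mem_of_superset
          (Filter.mem_lift' <| Filter.mem_iInf_of_mem δ <| Filter.mem_iInf_of_mem hδ <|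
            Filter.mem_principal_self _) ?_)
        rintro ⟨x, z⟩ ⟨y, h₁, h₂⟩
        simp only [mem_ofPred_eq] at h₁ h₂ ⊢
        have h := hC (x.1 - y.1) (y.1 - z.1)
        rw [sub_add_sub_cancel] at h
        rcases eq_or_ne C 0 with rfl | hC0
        · exact lt_of_le_of_lt (by simpa using h) hε
        · refine lt_of_le_of_lt h (lt_of_lt_of_le ?_ hδε)
          exact (ENNReal.mul_lt_mul_iff_right (by simpa using hC0) ENNReal.coe_ne_top).2
            (ENNReal.add_lt_add h₁ h₂) }

/-! ### Operators -/

/-- For a linear operator `T` on `S` and a space `{x | N x < ∞} ⊆ S`: the operator `T` maps this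
space into itself. -/
def MapsSpace {S : Submodule ℂ V} (T : S →ₗ[ℂ] S) (hN : N.space ≤ S) : Prop :=
  ∀ x : N.space, (T (Submodule.inclusion hN x) : V) ∈ N.space

/-- The restriction of `T` to the space `{x | N x < ∞}`. -/
def restrict {S : Submodule ℂ V} (T : S →ₗ[ℂ] S) (hN : N.space ≤ S) (hT : N.MapsSpace T hN) :
    N.Space →ₗ[ℂ] N.Space :=
  (S.subtype ∘ₗ T ∘ₗ Submodule.inclusion hN).codRestrict N.space hT

/-- `T` acts as a bounded linear operator on the quasi-normed space `{x | N x < ∞}`. -/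
def IsBoundedOn {S : Submodule ℂ V} (T : S →ₗ[ℂ] S) (hN : N.space ≤ S) : Prop :=
  ∃ hT : N.MapsSpace T hN, ∃ C : ℝ≥0, ∀ x : N.Space, N (N.restrict T hN hT x).1 ≤ C * N x.1

/-- `T` acts as a compact linear operator on the quasi-normed space `{x | N x < ∞}`. -/
def IsCompactOn {S : Submodule ℂ V} (T : S →ₗ[ℂ] S) (hN : N.space ≤ S) : Prop :=
  ∃ hT : N.MapsSpace T hN, IsCompactOperator (N.restrict T hN hT)

/-! ### Real interpolation -/

/-- The K-functional. A decomposition `f = f₀ + f₁` in which `f₀` or `f₁` is not in the space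
of the couple contributes `∞` (for `t > 0`). -/
def K (t : ℝ) (f : V) : ℝ≥0∞ :=
  ⨅ (f₀ : V) (f₁ : V) (_ : f₀ + f₁ = f), A₀ f₀ + ENNReal.ofReal t * A₁ f₁

theorem K_mono (f : V) : Monotone fun t : ℝ => K A₀ A₁ t f := by
  intro s t hst
  refine iInf_mono fun f₀ => iInf_mono fun f₁ => iInf_mono fun _ => ?_
  gcongr

theorem K_smul_le (t : ℝ) (c : ℂ) (f : V) : K A₀ A₁ t (c • f) ≤ ‖c‖ₑ * K A₀ A₁ t f := by
  simp only [K]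
  rcases eq_or_ne c 0 with rfl | hc
  · refine (iInf₂_le (0 : V) (0 : V)).trans ((iInf_le _ (by simp)).trans ?_)
    simp [map_zero]
  have h1 : ‖c‖ₑ ≠ 0 := by simpa using hc
  simp only [ENNReal.mul_iInf_of_ne h1 enorm_ne_top]
  refine le_iInf fun f₀ => le_iInf fun f₁ => le_iInf fun h => ?_
  refine (iInf₂_le (c • f₀) (c • f₁)).trans ((iInf_le _ (by rw [← h, smul_add])).trans ?_)
  rw [map_smul, map_smul, mul_add]
  exact le_of_eq (by ring)

theorem exists_K_add_le :
    ∃ C : ℝ≥0, ∀ (t : ℝ) (f g : V), K A₀ A₁ t (f + g) ≤ C * (K A₀ A₁ t f + K A₀ A₁ t g) := by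
  obtain ⟨C₀, h₀⟩ := A₀.add_le'
  obtain ⟨C₁, h₁⟩ := A₁.add_le'
  refine ⟨max C₀ C₁ + 1, fun t f g => ?_⟩
  set C : ℝ≥0 := max C₀ C₁ + 1 with hC
  have hC0 : (C : ℝ≥0∞) ≠ 0 := by
    rw [hC]; simp
  have hC₀ : (C₀ : ℝ≥0∞) ≤ C := by
    exact_mod_cast (le_max_left C₀ C₁).trans (le_add_of_nonneg_right zero_le_one)
  have hC₁ : (C₁ : ℝ≥0∞) ≤ C := by
    exact_mod_cast (le_max_right C₀ C₁).trans (le_add_of_nonneg_right zero_le_one)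
  simp only [K, ENNReal.mul_iInf_of_ne hC0 ENNReal.coe_ne_top, ENNReal.iInf_add,
    ENNReal.add_iInf]
  refine le_iInf fun g₀ => le_iInf fun g₁ => le_iInf fun hg => ?_
  refine le_iInf fun f₀ => le_iInf fun f₁ => le_iInf fun hf => ?_
  refine (iInf₂_le (f₀ + g₀) (f₁ + g₁)).trans
    ((iInf_le _ (by rw [← hf, ← hg]; abel)).trans ?_)
  calc A₀ (f₀ + g₀) + ENNReal.ofReal t * A₁ (f₁ + g₁)
      ≤ C * (A₀ f₀ + A₀ g₀) + ENNReal.ofReal t * (C * (A₁ f₁ + A₁ g₁)) := by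
        gcongr
        · exact (h₀ _ _).trans (by gcongr)
        · exact (h₁ _ _).trans (by gcongr)
    _ = C * (A₀ f₀ + ENNReal.ofReal t * A₁ f₁ + (A₀ g₀ + ENNReal.ofReal t * A₁ g₁)) := by ring

/-- The functional `‖f‖_{θ,q}`, `0 < q ≤ ∞`: the `L^q(dt/t)` quasi-norm of `t ↦ t^{-θ} K(t, f)`
on `(0, ∞)`, a supremum if `q = ∞`. -/
def interpNorm (θ : ℝ) (q : ℝ≥0∞) (f : V) : ℝ≥0∞ :=
  if q = ∞ then ⨆ t ∈ Ioi (0 : ℝ), ENNReal.ofReal (t ^ (-θ)) * K A₀ A₁ t f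
  else (∫⁻ t in Ioi (0 : ℝ), (ENNReal.ofReal (t ^ (-θ)) * K A₀ A₁ t f) ^ q.toReal
    * ENNReal.ofReal t⁻¹) ^ (1 / q.toReal)

end ExtQuasiNorm

theorem ENNReal.add_rpow_le_two_rpow_mul (a b : ℝ≥0∞) {s : ℝ} (hs : 0 < s) :
    (a + b) ^ s ≤ 2 ^ s * (a ^ s + b ^ s) := by
  wlog h : a ≤ b generalizing a b
  · rw [add_comm a, add_comm (a ^ s)]
    exact this b a (le_of_not_ge h)
  calc (a + b) ^ s ≤ (2 * b) ^ s := by rw [two_mul]; gcongr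
    _ = 2 ^ s * b ^ s := ENNReal.mul_rpow_of_nonneg _ _ hs.le
    _ ≤ 2 ^ s * (a ^ s + b ^ s) := by gcongr; exact le_add_self

namespace ExtQuasiNorm

/-- One inequality in the homogeneity condition suffices. -/
def ofSMulLE (F : V → ℝ≥0∞) (hs : ∀ (c : ℂ) (x : V), F (c • x) ≤ ‖c‖ₑ * F x)
    (ha : ∃ C : ℝ≥0, ∀ x y : V, F (x + y) ≤ C * (F x + F y)) : ExtQuasiNorm V where
  toFun := F
  map_smul' := by
    intro c x
    refine le_antisymm (hs c x) ?_
    rcases eq_or_ne c 0 with rfl | hc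
    · simp
    have h := hs c⁻¹ (c • x)
    rw [inv_smul_smul₀ hc, enorm_inv hc] at h
    have h1 : ‖c‖ₑ ≠ 0 := by simpa using hc
    calc ‖c‖ₑ * F x ≤ ‖c‖ₑ * (‖c‖ₑ⁻¹ * F (c • x)) := by gcongr
      _ = F (c • x) := by rw [← mul_assoc, ENNReal.mul_inv_cancel h1 enorm_ne_top, one_mul]
  add_le' := ha

variable (A₀ A₁ : ExtQuasiNorm V)

theorem measurable_K (f : V) : Measurable fun t : ℝ => K A₀ A₁ t f :=
  (K_mono A₀ A₁ f).measurable

theorem interpNorm_smul_le (θ : ℝ) {q : ℝ≥0∞} (hq : 0 < q) (c : ℂ) (f : V) :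
    interpNorm A₀ A₁ θ q (c • f) ≤ ‖c‖ₑ * interpNorm A₀ A₁ θ q f := by
  unfold interpNorm
  split_ifs with h
  · simp only [ENNReal.mul_iSup]
    refine iSup₂_mono fun t _ => ?_
    calc _ ≤ ENNReal.ofReal (t ^ (-θ)) * (‖c‖ₑ * K A₀ A₁ t f) := by gcongr; exact K_smul_le ..
      _ = _ := by ring
  · have hq' : 0 < q.toReal := ENNReal.toReal_pos hq.ne' h
    set s := q.toReal
    calc _ ≤ (∫⁻ t in Ioi (0 : ℝ), ‖c‖ₑ ^ s * ((ENNReal.ofReal (t ^ (-θ)) * K A₀ A₁ t f) ^ s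
              * ENNReal.ofReal t⁻¹)) ^ (1 / s) := by
          refine ENNReal.rpow_le_rpow (lintegral_mono fun t => ?_) (by positivity)
          calc (ENNReal.ofReal (t ^ (-θ)) * K A₀ A₁ t (c • f)) ^ s * ENNReal.ofReal t⁻¹
              ≤ (ENNReal.ofReal (t ^ (-θ)) * (‖c‖ₑ * K A₀ A₁ t f)) ^ s
                  * ENNReal.ofReal t⁻¹ := by gcongr; exact K_smul_le A₀ A₁ t c f
            _ = (‖c‖ₑ * (ENNReal.ofReal (t ^ (-θ)) * K A₀ A₁ t f)) ^ s
                  * ENNReal.ofReal t⁻¹ := by rw [mul_left_comm]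
            _ = _ := by rw [ENNReal.mul_rpow_of_nonneg _ _ hq'.le, mul_assoc]
      _ = _ := by
          rw [lintegral_const_mul' _ _ (ENNReal.rpow_ne_top_of_nonneg hq'.le enorm_ne_top),
            ENNReal.mul_rpow_of_nonneg _ _ (by positivity), ← ENNReal.rpow_mul,
            mul_one_div_cancel hq'.ne', ENNReal.rpow_one]

theorem exists_interpNorm_add_le (θ : ℝ) {q : ℝ≥0∞} (hq : 0 < q) :
    ∃ C : ℝ≥0, ∀ f g : V, interpNorm A₀ A₁ θ q (f + g) ≤
      C * (interpNorm A₀ A₁ θ q f + interpNorm A₀ A₁ θ q g) := by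
  obtain ⟨C, hC⟩ := exists_K_add_le A₀ A₁
  by_cases h : q = ∞
  · refine ⟨C, fun f g => ?_⟩
    simp only [interpNorm, h, if_true]
    refine iSup₂_le fun t ht => ?_
    calc _ ≤ ENNReal.ofReal (t ^ (-θ)) * (C * (K A₀ A₁ t f + K A₀ A₁ t g)) := by
          gcongr; exact hC ..
      _ = C * (ENNReal.ofReal (t ^ (-θ)) * K A₀ A₁ t f
            + ENNReal.ofReal (t ^ (-θ)) * K A₀ A₁ t g) := by ring
      _ ≤ _ := by
          gcongr
          · exact le_iSup₂ (f := fun t (_ : t ∈ Ioi (0 : ℝ)) =>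
              ENNReal.ofReal (t ^ (-θ)) * K A₀ A₁ t f) t ht
          · exact le_iSup₂ (f := fun t (_ : t ∈ Ioi (0 : ℝ)) =>
              ENNReal.ofReal (t ^ (-θ)) * K A₀ A₁ t g) t ht
  · have hs : 0 < q.toReal := ENNReal.toReal_pos hq.ne' h
    set s := q.toReal with hs_def
    have hs' : 0 < 1 / s := by positivity
    refine ⟨C * 2 * 2 ^ (1 / s), fun f g => ?_⟩
    simp only [interpNorm, h, if_false, ← hs_def]
    set F : V → ℝ → ℝ≥0∞ := fun f t =>
      (ENNReal.ofReal (t ^ (-θ)) * K A₀ A₁ t f) ^ s * ENNReal.ofReal t⁻¹ with hF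
    have hm : ∀ f, Measurable (F f) := fun f => by
      have := measurable_K A₀ A₁ f
      simp only [hF]
      fun_prop
    have key : ∀ t, F (f + g) t ≤ (C * 2 : ℝ≥0∞) ^ s * (F f t + F g t) := by
      intro t
      calc F (f + g) t
          ≤ (C * (ENNReal.ofReal (t ^ (-θ)) * K A₀ A₁ t f
              + ENNReal.ofReal (t ^ (-θ)) * K A₀ A₁ t g)) ^ s * ENNReal.ofReal t⁻¹ := by
            have h1 : ENNReal.ofReal (t ^ (-θ)) * K A₀ A₁ t (f + g)
                ≤ C * (ENNReal.ofReal (t ^ (-θ)) * K A₀ A₁ t f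
                  + ENNReal.ofReal (t ^ (-θ)) * K A₀ A₁ t g) := by
              calc _ ≤ ENNReal.ofReal (t ^ (-θ)) * (C * (K A₀ A₁ t f + K A₀ A₁ t g)) := by
                    gcongr; exact hC ..
                _ = _ := by ring
            simp only [hF]
            gcongr
        _ ≤ (C ^ s * (2 ^ s * ((ENNReal.ofReal (t ^ (-θ)) * K A₀ A₁ t f) ^ s
              + (ENNReal.ofReal (t ^ (-θ)) * K A₀ A₁ t g) ^ s))) * ENNReal.ofReal t⁻¹ := by
            rw [ENNReal.mul_rpow_of_nonneg _ _ hs.le]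
            gcongr
            exact ENNReal.add_rpow_le_two_rpow_mul _ _ hs
        _ = _ := by
            rw [ENNReal.mul_rpow_of_nonneg (C : ℝ≥0∞) 2 hs.le]
            simp only [hF]
            rw [← mul_assoc, mul_assoc, add_mul]
    calc (∫⁻ t in Ioi (0 : ℝ), F (f + g) t) ^ (1 / s)
        ≤ (∫⁻ t in Ioi (0 : ℝ), (C * 2 : ℝ≥0∞) ^ s * (F f t + F g t)) ^ (1 / s) := by
          gcongr with t; exact key t
      _ = C * 2 * ((∫⁻ t in Ioi (0 : ℝ), F f t) + ∫⁻ t in Ioi (0 : ℝ), F g t) ^ (1 / s) := by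
          rw [lintegral_const_mul' _ _ (ENNReal.rpow_ne_top_of_nonneg hs.le (by finiteness)),
            lintegral_add_left (hm f),
            ENNReal.mul_rpow_of_nonneg _ _ hs'.le, ← ENNReal.rpow_mul,
            mul_one_div_cancel hs.ne', ENNReal.rpow_one]
      _ ≤ C * 2 * (2 ^ (1 / s) * ((∫⁻ t in Ioi (0 : ℝ), F f t) ^ (1 / s)
            + (∫⁻ t in Ioi (0 : ℝ), F g t) ^ (1 / s))) := by
          gcongr
          exact ENNReal.add_rpow_le_two_rpow_mul _ _ hs'
      _ = _ := by
          push_cast [ENNReal.coe_rpow_of_nonneg _ hs'.le]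
          ring

/-- The real interpolation space `(A₀, A₁)_{θ,q}`. -/
def interp (θ : ℝ) (q : ℝ≥0∞) (hq : 0 < q) : ExtQuasiNorm V :=
  ofSMulLE (interpNorm A₀ A₁ θ q) (interpNorm_smul_le A₀ A₁ θ hq)
    (exists_interpNorm_add_le A₀ A₁ θ hq)

/-- Finiteness of `‖f‖_{θ,q}` forces `f ∈ A₀ + A₁`, so that
`(A₀, A₁)_{θ,q} = {f ∈ A₀ + A₁ | ‖f‖_{θ,q} < ∞}`. -/
theorem interp_space_le (θ : ℝ) (q : ℝ≥0∞) (hq : 0 < q) :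
    (interp A₀ A₁ θ q hq).space ≤ A₀.space ⊔ A₁.space := by
  intro f hf
  by_contra hcon
  have hK : ∀ t : ℝ, 0 < t → K A₀ A₁ t f = ∞ := by
    intro t ht
    simp only [K, iInf_eq_top]
    intro f₀ f₁ h
    by_contra hne
    obtain ⟨h0, h1⟩ := ENNReal.add_lt_top.1 (lt_top_iff_ne_top.2 hne)
    refine hcon (Submodule.mem_sup.2 ⟨f₀, h0, f₁, ?_, h⟩)
    by_contra h2
    have h3 : A₁ f₁ = ∞ := not_lt_top_iff.1 h2
    rw [h3, ENNReal.mul_top (by simpa using ht)] at h1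
    exact lt_irrefl _ h1
  have hf' : interpNorm A₀ A₁ θ q f < ∞ := hf
  refine hf'.ne ?_
  unfold interpNorm
  split_ifs with h
  · refine top_le_iff.1 (le_trans ?_ (le_iSup₂ (1 : ℝ) (show (1 : ℝ) ∈ Ioi 0 by simp)))
    simp [hK 1 one_pos]
  · have hs : 0 < q.toReal := ENNReal.toReal_pos hq.ne' h
    have h1 : (∫⁻ t in Ioi (0 : ℝ), (ENNReal.ofReal (t ^ (-θ)) * K A₀ A₁ t f) ^ q.toReal
        * ENNReal.ofReal t⁻¹) = ∫⁻ _ in Ioi (0 : ℝ), ∞ := by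
      refine setLIntegral_congr_fun measurableSet_Ioi fun t (ht : 0 < t) => ?_
      have h2 : 0 < t ^ (-θ) := Real.rpow_pos_of_pos ht _
      rw [hK t ht, ENNReal.mul_top (by simpa using h2), ENNReal.top_rpow_of_pos hs,
        ENNReal.top_mul (by simpa using ht)]
    rw [h1]
    simp [hs]

end ExtQuasiNorm

end Quasi

/-! ### Hardy spaces on the unit disc -/

/-- `Hol(𝔻)`, the holomorphic functions on the unit disc. -/
def Hol : Submodule ℂ (𝔻 → ℂ) where
  carrier := {f | ∃ g : ℂ → ℂ, DifferentiableOn ℂ g (Metric.ball 0 1) ∧ ∀ z : 𝔻, f z = g z}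
  add_mem' := by
    rintro f₁ f₂ ⟨g₁, h₁, e₁⟩ ⟨g₂, h₂, e₂⟩
    exact ⟨g₁ + g₂, h₁.add h₂, fun z => by simp [e₁, e₂]⟩
  zero_mem' := ⟨0, differentiableOn_const 0, fun z => rfl⟩
  smul_mem' := by
    rintro c f ⟨g, h, e⟩
    exact ⟨c • g, h.const_smul c, fun z => by simp [e]⟩

theorem norm_circleMap_zero_lt_one (r : Ioo (0 : ℝ) 1) (t : ℝ) : ‖circleMap 0 r t‖ < 1 := by
  rw [norm_circleMap_zero, abs_of_pos r.2.1]
  exact r.2.2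

/-- The point `r e^{it}` of the unit disc, `0 < r < 1`. -/
def circlePoint (r : Ioo (0 : ℝ) 1) (t : ℝ) : 𝔻 :=
  UnitDisc.mk (circleMap 0 r t) (norm_circleMap_zero_lt_one r t)

/-- The mean of `|f(r ζ)|^p` over the unit circle, with respect to the normalized Lebesgue
measure. -/
def circleMean (p : ℝ) (r : Ioo (0 : ℝ) 1) (f : Hol) : ℝ≥0∞ :=
  ENNReal.ofReal (2 * Real.pi)⁻¹ *
    ∫⁻ t in Ioc 0 (2 * Real.pi), ‖(f : 𝔻 → ℂ) (circlePoint r t)‖ₑ ^ p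

/-- `‖f‖_{H^p} = (sup_{0 < r < 1} ∫ |f(r ζ)|^p dm(ζ))^{1/p}`. -/
def hardyNorm (p : ℝ) (f : Hol) : ℝ≥0∞ :=
  (⨆ r : Ioo (0 : ℝ) 1, circleMean p r f) ^ (1 / p)

theorem continuous_comp_circlePoint (f : Hol) (r : Ioo (0 : ℝ) 1) :
    Continuous fun t => (f : 𝔻 → ℂ) (circlePoint r t) := by
  obtain ⟨g, hg, e⟩ := f.2
  have h : (fun t => (f : 𝔻 → ℂ) (circlePoint r t)) = fun t => g (circleMap 0 r t) := by
    funext t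
    exact e _
  rw [h]
  exact hg.continuousOn.comp_continuous (continuous_circleMap 0 _)
    fun t => by simpa using norm_circleMap_zero_lt_one r t

theorem circleMean_add_le {p : ℝ} (hp : 0 < p) (r : Ioo (0 : ℝ) 1) (f g : Hol) :
    circleMean p r (f + g) ≤ 2 ^ p * (circleMean p r f + circleMean p r g) := by
  have hm : ∀ f : Hol, Measurable fun t => ‖(f : 𝔻 → ℂ) (circlePoint r t)‖ₑ ^ p := fun f =>
    ((continuous_comp_circlePoint f r).measurable.enorm).pow_const p
  unfold circleMean
  calc _ ≤ ENNReal.ofReal (2 * Real.pi)⁻¹ * ∫⁻ t in Ioc 0 (2 * Real.pi),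
          2 ^ p * (‖(f : 𝔻 → ℂ) (circlePoint r t)‖ₑ ^ p
            + ‖(g : 𝔻 → ℂ) (circlePoint r t)‖ₑ ^ p) := by
        gcongr with t
        refine le_trans ?_ (ENNReal.add_rpow_le_two_rpow_mul _ _ hp)
        gcongr
        exact enorm_add_le _ _
    _ = _ := by
        rw [lintegral_const_mul' _ _ (ENNReal.rpow_ne_top_of_nonneg hp.le (by finiteness)),
          lintegral_add_left (hm f)]
        ring

theorem circleMean_smul {p : ℝ} (hp : 0 < p) (r : Ioo (0 : ℝ) 1) (c : ℂ) (f : Hol) :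
    circleMean p r (c • f) = ‖c‖ₑ ^ p * circleMean p r f := by
  unfold circleMean
  simp only [Submodule.coe_smul, Pi.smul_apply, smul_eq_mul, enorm_mul,
    ENNReal.mul_rpow_of_nonneg _ _ hp.le]
  rw [lintegral_const_mul' _ _ (ENNReal.rpow_ne_top_of_nonneg hp.le enorm_ne_top)]
  ring

/-- The Hardy space `H^p(𝔻)`, `0 < p < ∞`. -/
def hardy (p : ℝ) (hp : 0 < p) : ExtQuasiNorm Hol where
  toFun := hardyNorm p
  map_smul' := by
    intro c f
    simp only [hardyNorm, circleMean_smul hp, ← ENNReal.mul_iSup]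
    rw [ENNReal.mul_rpow_of_nonneg _ _ (by positivity), ← ENNReal.rpow_mul,
      mul_one_div_cancel hp.ne', ENNReal.rpow_one]
  add_le' := by
    have hp' : 0 < 1 / p := by positivity
    refine ⟨2 * 2 ^ (1 / p), fun f g => ?_⟩
    unfold hardyNorm
    calc _ ≤ (2 ^ p * ((⨆ r, circleMean p r f) + ⨆ r, circleMean p r g)) ^ (1 / p) := by
          gcongr
          refine iSup_le fun r => (circleMean_add_le hp r f g).trans ?_
          gcongr
          · exact le_iSup (fun r => circleMean p r f) r
          · exact le_iSup (fun r => circleMean p r g) r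
      _ ≤ 2 * (2 ^ (1 / p) * ((⨆ r, circleMean p r f) ^ (1 / p)
            + (⨆ r, circleMean p r g) ^ (1 / p))) := by
          rw [ENNReal.mul_rpow_of_nonneg _ _ hp'.le, ← ENNReal.rpow_mul,
            mul_one_div_cancel hp.ne', ENNReal.rpow_one]
          gcongr
          exact ENNReal.add_rpow_le_two_rpow_mul _ _ hp'
      _ = _ := by
          push_cast [ENNReal.coe_rpow_of_nonneg _ hp'.le]
          ring

end

/-!
# One-sided compactness for the real interpolation of Hardy spaces

The result holds for every couple `A₀, A₁` of complete quasi-normed spaces that is separated in the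
sense that `K(1, f) = 0` only for `f = 0` (`ExtQuasiNorm.isCompactOn_interp`); no density of smooth
functions is needed. Given `x` in the interpolation space, choose for every `t > 0` a decomposition
`x = a(t) + (x - a(t))` that attains `K(t, x)` up to a factor `2`, and for small `ρ` and large `M`
write `T x = T a(ρ) + T (a(M) - a(ρ)) + T (x - a(M))`.

* The elements `a(s) - a(ρ)`, `s < ρ`, are much smaller in `A₀` than in `A₁`. As `T` is compact on
  `A₁` and the couple is separated, `T` has a small norm `δ` on such elements. This gives
  `K(t, T a(ρ)) ≲ K(δ t, x)`, whose interpolation norm gains the factor `δ^θ`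
  (`IsNearOptimal.K_map_left_le`).
* As `T` is compact on `A₁`, images of elements of `A₀ ∩ A₁` that are bounded in `A₁` lie within
  `ε` in `A₁` of a bounded subset of `A₀`. Applied to `a(r t) - a(max (M, ε r t))`, this gives
  `K(t, T (x - a(M))) ≲ K(ε r t, x) + r⁻¹ K(r t, x)`, which is small in the interpolation norm if
  first `r` is chosen large and then `ε` small (`IsNearOptimal.K_map_right_le`).
* The elements `a(M) - a(ρ)` are bounded in `A₀ ∩ A₁`, so that their images are bounded in `A₀` and
  totally bounded in `A₁`, hence totally bounded in between.

So the image of the unit ball is totally bounded (`IsSeqCompactMap.exists_interpNorm_net`), and its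
closure is compact since the interpolation space is complete (`completeSpace_interp`).

For the Hardy spaces, separation and completeness follow from the boundedness of point evaluations,
uniformly on compact subsets of the disc (`exists_enorm_apply_le_hardyNorm`). For `p ≤ 1` this is
obtained from Cauchy's formula alone (`mul_norm_rpow_le_of_circleMean_le`); larger exponents reduce
to `p = 1` by Hölder's inequality.
-/

/-! ### The weighted `L^q(dt/t)` functional -/

/-- The functional `k ↦ ‖t^{-θ} k(t)‖_{L^q(dt/t)}` on functions `(0, ∞) → [0, ∞]`, which turns the
K-functional of `f` into `‖f‖_{θ,q}`. -/
noncomputable def weightedLq (θ : ℝ) (q : ℝ≥0∞) (k : ℝ → ℝ≥0∞) : ℝ≥0∞ :=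
  if q = ∞ then ⨆ t ∈ Ioi (0 : ℝ), ENNReal.ofReal (t ^ (-θ)) * k t
  else (∫⁻ t in Ioi (0 : ℝ), (ENNReal.ofReal (t ^ (-θ)) * k t) ^ q.toReal
    * ENNReal.ofReal t⁻¹) ^ (1 / q.toReal)

section weightedLq

variable {θ : ℝ} {q : ℝ≥0∞}

theorem weightedLq_mono (hq : 0 < q) {k l : ℝ → ℝ≥0∞} (h : ∀ t, 0 < t → k t ≤ l t) :
    weightedLq θ q k ≤ weightedLq θ q l := by
  unfold weightedLq
  split_ifs with hqt
  · exact iSup₂_mono fun t ht => by gcongr; exact h t ht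
  · have hs : 0 < q.toReal := ENNReal.toReal_pos hq.ne' hqt
    refine ENNReal.rpow_le_rpow (setLIntegral_mono' measurableSet_Ioi fun t ht => ?_)
      (by positivity)
    gcongr
    exact h t ht

theorem weightedLq_const_mul (hq : 0 < q) {c : ℝ≥0∞} (hc : c ≠ ∞) (k : ℝ → ℝ≥0∞) :
    weightedLq θ q (fun t => c * k t) = c * weightedLq θ q k := by
  unfold weightedLq
  split_ifs with hqt
  · simp only [ENNReal.mul_iSup]
    exact iSup_congr fun t => iSup_congr fun _ => by ring
  · have hs : 0 < q.toReal := ENNReal.toReal_pos hq.ne' hqt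
    set s := q.toReal
    have : ∀ t : ℝ, (ENNReal.ofReal (t ^ (-θ)) * (c * k t)) ^ s * ENNReal.ofReal t⁻¹
        = c ^ s * ((ENNReal.ofReal (t ^ (-θ)) * k t) ^ s * ENNReal.ofReal t⁻¹) := fun t => by
      rw [mul_left_comm, ENNReal.mul_rpow_of_nonneg _ _ hs.le, mul_assoc]
    simp only [this]
    rw [lintegral_const_mul' _ _ (ENNReal.rpow_ne_top_of_nonneg hs.le hc),
      ENNReal.mul_rpow_of_nonneg _ _ (by positivity), ← ENNReal.rpow_mul,
      mul_one_div_cancel hs.ne', ENNReal.rpow_one]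

theorem exists_weightedLq_add_le (θ : ℝ) (hq : 0 < q) :
    ∃ C : ℝ≥0, ∀ k l : ℝ → ℝ≥0∞, Measurable k → Measurable l →
      weightedLq θ q (fun t => k t + l t) ≤ C * (weightedLq θ q k + weightedLq θ q l) := by
  by_cases hqt : q = ∞
  · refine ⟨1, fun k l _ _ => ?_⟩
    simp only [weightedLq, hqt, if_true, ENNReal.coe_one, one_mul]
    refine iSup₂_le fun t ht => ?_
    rw [mul_add]
    gcongr
    · exact le_iSup₂ (f := fun t (_ : t ∈ Ioi (0 : ℝ)) => ENNReal.ofReal (t ^ (-θ)) * k t) t ht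
    · exact le_iSup₂ (f := fun t (_ : t ∈ Ioi (0 : ℝ)) => ENNReal.ofReal (t ^ (-θ)) * l t) t ht
  · have hs : 0 < q.toReal := ENNReal.toReal_pos hq.ne' hqt
    set s := q.toReal with hs_def
    have hs' : 0 < 1 / s := by positivity
    refine ⟨2 * 2 ^ (1 / s), fun k l hk hl => ?_⟩
    simp only [weightedLq, hqt, if_false, ← hs_def]
    set F : (ℝ → ℝ≥0∞) → ℝ → ℝ≥0∞ := fun k t =>
      (ENNReal.ofReal (t ^ (-θ)) * k t) ^ s * ENNReal.ofReal t⁻¹ with hF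
    have hm : Measurable (F k) := by
      simp only [hF]
      fun_prop
    have key : ∀ t, F (fun t => k t + l t) t ≤ 2 ^ s * (F k t + F l t) := by
      intro t
      simp only [hF]
      rw [← add_mul, ← mul_assoc, mul_add]
      gcongr
      exact ENNReal.add_rpow_le_two_rpow_mul _ _ hs
    calc (∫⁻ t in Ioi (0 : ℝ), F (fun t => k t + l t) t) ^ (1 / s)
        ≤ (∫⁻ t in Ioi (0 : ℝ), 2 ^ s * (F k t + F l t)) ^ (1 / s) := by
          gcongr with t; exact key t
      _ = 2 * ((∫⁻ t in Ioi (0 : ℝ), F k t) + ∫⁻ t in Ioi (0 : ℝ), F l t) ^ (1 / s) := by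
          rw [lintegral_const_mul' _ _ (ENNReal.rpow_ne_top_of_nonneg hs.le (by finiteness)),
            lintegral_add_left hm,
            ENNReal.mul_rpow_of_nonneg _ _ hs'.le, ← ENNReal.rpow_mul,
            mul_one_div_cancel hs.ne', ENNReal.rpow_one]
      _ ≤ 2 * (2 ^ (1 / s) * ((∫⁻ t in Ioi (0 : ℝ), F k t) ^ (1 / s)
            + (∫⁻ t in Ioi (0 : ℝ), F l t) ^ (1 / s))) := by
          gcongr
          exact ENNReal.add_rpow_le_two_rpow_mul _ _ hs'
      _ = _ := by
          push_cast [ENNReal.coe_rpow_of_nonneg _ hs'.le]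
          ring

/-- Scaling: the measure `dt/t` is invariant under dilations. -/
theorem weightedLq_comp_mul_le (hq : 0 < q) {δ : ℝ} (hδ : 0 < δ) (k : ℝ → ℝ≥0∞) :
    weightedLq θ q (fun t => k (δ * t)) ≤ ENNReal.ofReal (δ ^ θ) * weightedLq θ q k := by
  have hw : ∀ t : ℝ, 0 < t → ENNReal.ofReal (t ^ (-θ))
      = ENNReal.ofReal (δ ^ θ) * ENNReal.ofReal ((δ * t) ^ (-θ)) := fun t ht => by
    rw [← ENNReal.ofReal_mul (by positivity), Real.mul_rpow hδ.le ht.le, ← mul_assoc,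
      ← Real.rpow_add hδ, add_neg_cancel, Real.rpow_zero, one_mul]
  unfold weightedLq
  split_ifs with hqt
  · simp only [ENNReal.mul_iSup]
    refine iSup₂_le fun t (ht : 0 < t) => ?_
    rw [hw t ht, mul_assoc]
    exact le_iSup₂ (f := fun t (_ : t ∈ Ioi (0 : ℝ)) =>
      ENNReal.ofReal (δ ^ θ) * (ENNReal.ofReal (t ^ (-θ)) * k t)) (δ * t) (mul_pos hδ ht)
  · have hs : 0 < q.toReal := ENNReal.toReal_pos hq.ne' hqt
    set s := q.toReal
    set F : ℝ → ℝ≥0∞ := (Ioi 0).indicator fun t =>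
      (ENNReal.ofReal (t ^ (-θ)) * k t) ^ s * ENNReal.ofReal t⁻¹ with hF
    have h1 : ∀ t : ℝ, (Ioi 0).indicator (fun t =>
        (ENNReal.ofReal (t ^ (-θ)) * k (δ * t)) ^ s * ENNReal.ofReal t⁻¹) t
        = ENNReal.ofReal (δ ^ θ) ^ s * ENNReal.ofReal δ * F (δ * t) := fun t => by
      by_cases ht : 0 < t
      · have ht' : 0 < δ * t := mul_pos hδ ht
        simp only [hF, indicator_of_mem (mem_Ioi.2 ht), indicator_of_mem (mem_Ioi.2 ht')]
        rw [hw t ht, mul_assoc, ENNReal.mul_rpow_of_nonneg _ _ hs.le]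
        have : ENNReal.ofReal t⁻¹ = ENNReal.ofReal δ * ENNReal.ofReal (δ * t)⁻¹ := by
          rw [← ENNReal.ofReal_mul hδ.le]
          congr 1
          field_simp
        rw [this]
        ring
      · have ht' : ¬ 0 < δ * t := fun h => ht ((mul_pos_iff_of_pos_left hδ).1 h)
        simp [hF, ht, ht']
    have h2 : ∫⁻ t, F (δ * t) = ENNReal.ofReal δ⁻¹ * ∫⁻ t, F t := by
      have hme : MeasurableEmbedding (fun t : ℝ => δ * t) :=
        (Homeomorph.mulLeft₀ δ hδ.ne').measurableEmbedding
      rw [← hme.lintegral_map, Real.map_volume_mul_left hδ.ne', lintegral_smul_measure,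
        abs_of_pos (by positivity), smul_eq_mul]
    rw [← lintegral_indicator measurableSet_Ioi, ← lintegral_indicator measurableSet_Ioi]
    simp only [h1]
    rw [lintegral_const_mul' _ _ (by finiteness), h2, ← mul_assoc, mul_assoc (_ ^ s),
      ← ENNReal.ofReal_mul hδ.le, mul_inv_cancel₀ hδ.ne', ENNReal.ofReal_one, mul_one,
      ENNReal.mul_rpow_of_nonneg _ _ (by positivity), ← ENNReal.rpow_mul,
      mul_one_div_cancel hs.ne', ENNReal.rpow_one]

/-- `min(1, t)` is the K-functional of an element of norm one in both spaces of a couple. -/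
theorem weightedLq_min_one_lt_top (hθ₀ : 0 < θ) (hθ₁ : θ < 1) (hq : 0 < q) :
    weightedLq θ q (fun t => ENNReal.ofReal (min 1 t)) < ∞ := by
  unfold weightedLq
  split_ifs with hqt
  · refine (iSup₂_le (a := 1) fun t (ht : 0 < t) => ?_).trans_lt ENNReal.one_lt_top
    rw [← ENNReal.ofReal_mul (by positivity), ENNReal.ofReal_le_one]
    rcases le_total t 1 with h | h
    · rw [min_eq_right h, ← Real.rpow_add_one ht.ne']
      exact Real.rpow_le_one ht.le h (by linarith)
    · rw [min_eq_left h, mul_one]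
      exact Real.rpow_le_one_of_one_le_of_nonpos h (by linarith)
  · have hs : 0 < q.toReal := ENNReal.toReal_pos hq.ne' hqt
    set s := q.toReal
    refine ENNReal.rpow_lt_top_of_nonneg (by positivity) (ne_of_lt ?_)
    have hF : ∀ t : ℝ, 0 < t →
        (ENNReal.ofReal (t ^ (-θ)) * ENNReal.ofReal (min 1 t)) ^ s * ENNReal.ofReal t⁻¹
          = ENNReal.ofReal ((t ^ (-θ) * min 1 t) ^ s * t⁻¹) := fun t ht => by
      have : 0 < min 1 t := lt_min one_pos ht
      rw [← ENNReal.ofReal_mul (by positivity),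
        ENNReal.ofReal_rpow_of_nonneg (by positivity) hs.le,
        ← ENNReal.ofReal_mul (by positivity)]
    have hsmall : IntegrableOn (fun t : ℝ => t ^ ((1 - θ) * s - 1)) (Ioo 0 1) :=
      (intervalIntegral.integrableOn_Ioo_rpow_iff one_pos).2 (by nlinarith)
    have hlarge : IntegrableOn (fun t : ℝ => t ^ (-θ * s - 1)) (Ioi (1 / 2)) :=
      integrableOn_Ioi_rpow_of_lt (by nlinarith) (by norm_num)
    have hcover : Ioi (0 : ℝ) ⊆ Ioo 0 1 ∪ Ici 1 := fun t (ht : 0 < t) => by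
      rcases lt_or_ge t 1 with h | h
      · exact Or.inl ⟨ht, h⟩
      · exact Or.inr h
    refine (lintegral_mono_set hcover).trans_lt ((lintegral_union_le _ _ _).trans_lt
      (ENNReal.add_lt_top.2 ⟨?_, ?_⟩))
    · refine lt_of_eq_of_lt (setLIntegral_congr_fun measurableSet_Ioo fun t ht => ?_)
        hsmall.lintegral_lt_top
      beta_reduce
      rw [hF t ht.1, min_eq_right ht.2.le, ← Real.rpow_add_one ht.1.ne', ← Real.rpow_mul ht.1.le,
        ← Real.rpow_neg_one t, ← Real.rpow_add ht.1]
      ring_nf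
    · refine lt_of_eq_of_lt (setLIntegral_congr_fun measurableSet_Ici fun t (ht : 1 ≤ t) => ?_)
        (hlarge.mono_set fun t (ht : 1 ≤ t) => show 1 / 2 < t by linarith).lintegral_lt_top
      have ht0 : 0 < t := by linarith
      beta_reduce
      rw [hF t ht0, min_eq_left ht, mul_one, ← Real.rpow_mul ht0.le,
        ← Real.rpow_neg_one t, ← Real.rpow_add ht0]
      ring_nf

theorem weightedLq_indicator_Ici_ne_zero (θ : ℝ) (hq : 0 < q) :
    weightedLq θ q ((Ici 1).indicator fun _ => 1) ≠ 0 := by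
  unfold weightedLq
  split_ifs with hqt
  · refine (lt_of_lt_of_le ?_ (le_iSup₂ (1 : ℝ) (show (1 : ℝ) ∈ Ioi 0 by simp))).ne'
    simp
  · have hs : 0 < q.toReal := ENNReal.toReal_pos hq.ne' hqt
    intro h
    rw [ENNReal.rpow_eq_zero_iff_of_pos (by positivity),
      setLIntegral_eq_zero_iff measurableSet_Ioi
        (by have : Measurable ((Ici (1 : ℝ)).indicator fun _ => (1 : ℝ≥0∞)) :=
              measurable_const.indicator measurableSet_Ici
            fun_prop)] at h
    have h1 : volume (Ici (1 : ℝ)) = 0 := by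
      refine measure_mono_null (fun t (ht : 1 ≤ t) => ?_) h
      have ht0 : 0 < t := by linarith
      have : 0 < t ^ (-θ) := by positivity
      simp [ht, ht0, hs.not_gt, this]
    simp at h1

/-- The value at `1` of a monotone function is controlled by its weighted norm. -/
theorem exists_apply_one_le_weightedLq (hθ₀ : 0 < θ) (hθ₁ : θ < 1) (hq : 0 < q) :
    ∃ C : ℝ≥0, ∀ k : ℝ → ℝ≥0∞, Monotone k → k 1 ≠ ∞ → k 1 ≤ C * weightedLq θ q k := by
  set c := weightedLq θ q ((Ici 1).indicator fun _ => 1) with hc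
  have hc0 : c ≠ 0 := weightedLq_indicator_Ici_ne_zero θ hq
  have hct : c ≠ ∞ := by
    refine ((weightedLq_mono hq fun t ht => ?_).trans_lt
      (weightedLq_min_one_lt_top hθ₀ hθ₁ hq)).ne
    by_cases h : 1 ≤ t
    · simp [h]
    · simp [h]
  refine ⟨c⁻¹.toNNReal, fun k hk hk1 => ?_⟩
  rw [ENNReal.coe_toNNReal (by simpa using hc0)]
  have h1 : k 1 * c ≤ weightedLq θ q k := by
    rw [hc, ← weightedLq_const_mul hq hk1]
    refine weightedLq_mono hq fun t _ => ?_
    by_cases h : 1 ≤ t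
    · simpa [h] using hk h
    · simp [h]
  calc k 1 = c⁻¹ * (k 1 * c) := by
        rw [mul_comm, mul_assoc, ENNReal.mul_inv_cancel hc0 hct, mul_one]
    _ ≤ _ := by gcongr

/-- Fatou's lemma. -/
theorem weightedLq_le_of_le_liminf (hq : 0 < q) {k : ℝ → ℝ≥0∞} {l : ℕ → ℝ → ℝ≥0∞} {e : ℝ≥0∞}
    (hl : ∀ m, Measurable (l m))
    (h : ∀ t, 0 < t → k t ≤ Filter.liminf (fun m => l m t) Filter.atTop)
    (he : ∀ᶠ m in Filter.atTop, weightedLq θ q (l m) ≤ e) : weightedLq θ q k ≤ e := by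
  unfold weightedLq at he ⊢
  split_ifs at he ⊢ with hqt
  · refine iSup₂_le fun t ht => ?_
    calc _ ≤ ENNReal.ofReal (t ^ (-θ)) * Filter.liminf (fun m => l m t) Filter.atTop := by
          gcongr; exact h t ht
      _ = Filter.liminf (fun m => ENNReal.ofReal (t ^ (-θ)) * l m t) Filter.atTop :=
          (ENNReal.liminf_const_mul_of_ne_top ENNReal.ofReal_ne_top).symm
      _ ≤ e := by
          refine Filter.liminf_le_of_frequently_le' (Filter.Eventually.frequently ?_)
          filter_upwards [he] with m hm
          exact (le_iSup₂ (f := fun t (_ : t ∈ Ioi (0 : ℝ)) =>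
            ENNReal.ofReal (t ^ (-θ)) * l m t) t ht).trans hm
  · have hs : 0 < q.toReal := ENNReal.toReal_pos hq.ne' hqt
    set s := q.toReal
    rw [one_div, ENNReal.rpow_inv_le_iff hs]
    set F : ℕ → ℝ → ℝ≥0∞ := fun m t =>
      (ENNReal.ofReal (t ^ (-θ)) * l m t) ^ s * ENNReal.ofReal t⁻¹ with hF
    have hFm : ∀ m, Measurable (F m) := fun m => by
      have := hl m
      simp only [hF]
      fun_prop
    calc _ ≤ ∫⁻ t in Ioi (0 : ℝ), Filter.liminf (fun m => F m t) Filter.atTop := by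
          refine setLIntegral_mono' measurableSet_Ioi fun t ht => ?_
          calc _ ≤ (ENNReal.ofReal (t ^ (-θ)) * Filter.liminf (fun m => l m t) Filter.atTop) ^ s
                * ENNReal.ofReal t⁻¹ := by gcongr; exact h t ht
            _ = _ := by
              have hmono : Monotone fun x : ℝ≥0∞ => x ^ s := ENNReal.monotone_rpow_of_nonneg hs.le
              rw [← ENNReal.liminf_const_mul_of_ne_top ENNReal.ofReal_ne_top,
                hmono.map_liminf_of_continuousAt _ ENNReal.continuous_rpow_const.continuousAt,
                mul_comm, ← ENNReal.liminf_const_mul_of_ne_top ENNReal.ofReal_ne_top]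
              simp only [hF, Function.comp_apply, mul_comm (ENNReal.ofReal t⁻¹)]
      _ ≤ Filter.liminf (fun m => ∫⁻ t in Ioi (0 : ℝ), F m t) Filter.atTop :=
          lintegral_liminf_le hFm
      _ ≤ e ^ s := by
          refine Filter.liminf_le_of_frequently_le' (Filter.Eventually.frequently ?_)
          filter_upwards [he] with m hm
          rwa [one_div, ENNReal.rpow_inv_le_iff hs] at hm

end weightedLq

/-! ### The K-functional and nearly optimal decompositions -/

namespace ExtQuasiNorm

section Couple

variable {V : Type*} [AddCommGroup V] [Module ℂ V] (A₀ A₁ : ExtQuasiNorm V)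

theorem interpNorm_eq_weightedLq (θ : ℝ) (q : ℝ≥0∞) (f : V) :
    interpNorm A₀ A₁ θ q f = weightedLq θ q fun t => K A₀ A₁ t f := rfl

theorem K_add_le (t : ℝ) (f₀ f₁ : V) :
    K A₀ A₁ t (f₀ + f₁) ≤ A₀ f₀ + ENNReal.ofReal t * A₁ f₁ :=
  (iInf₂_le f₀ f₁).trans (iInf_le _ rfl)

theorem K_le_left (t : ℝ) (f : V) : K A₀ A₁ t f ≤ A₀ f := by
  simpa [map_zero] using K_add_le A₀ A₁ t f 0

theorem K_le_right (t : ℝ) (f : V) : K A₀ A₁ t f ≤ ENNReal.ofReal t * A₁ f := by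
  simpa [map_zero] using K_add_le A₀ A₁ t 0 f

theorem K_le_ofReal_mul {s r : ℝ} (hr : 1 ≤ r) (f : V) :
    K A₀ A₁ (r * s) f ≤ ENNReal.ofReal r * K A₀ A₁ s f := by
  have hr0 : ENNReal.ofReal r ≠ 0 := by
    simpa using one_pos.trans_le hr
  conv_rhs => rw [K]
  simp only [ENNReal.mul_iInf_of_ne hr0 ENNReal.ofReal_ne_top]
  refine le_iInf fun f₀ => le_iInf fun f₁ => le_iInf fun h => ?_
  rw [← h]
  refine (K_add_le A₀ A₁ _ f₀ f₁).trans ?_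
  rw [mul_add, ← mul_assoc, ENNReal.ofReal_mul (by linarith)]
  gcongr
  refine le_mul_of_one_le_left' ?_
  simpa using hr

theorem K_div_anti {s t : ℝ} (hs : 0 < s) (hst : s ≤ t) (f : V) :
    K A₀ A₁ t f / ENNReal.ofReal t ≤ K A₀ A₁ s f / ENNReal.ofReal s := by
  have ht : 0 < t := hs.trans_le hst
  have h := K_le_ofReal_mul A₀ A₁ (s := s) ((one_le_div hs).2 hst) f
  rw [div_mul_cancel₀ _ hs.ne', ENNReal.ofReal_div_of_pos hs] at h
  refine ENNReal.div_le_of_le_mul (h.trans (le_of_eq ?_))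
  simp only [div_eq_mul_inv]
  ring

theorem K_lt_top {f : V} (hf : K A₀ A₁ 1 f < ∞) (t : ℝ) : K A₀ A₁ t f < ∞ := by
  refine (K_mono A₀ A₁ f (le_max_right 1 t)).trans_lt ?_
  refine (?_ : K A₀ A₁ (max 1 t) f ≤ ENNReal.ofReal (max 1 t) * K A₀ A₁ 1 f).trans_lt
    (ENNReal.mul_lt_top ENNReal.ofReal_lt_top hf)
  simpa using K_le_ofReal_mul A₀ A₁ (s := 1) (le_max_left 1 t) f

theorem ofReal_mul_K_div {t : ℝ} (ht : 0 < t) (f : V) :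
    ENNReal.ofReal t * (K A₀ A₁ t f / ENNReal.ofReal t) = K A₀ A₁ t f :=
  ENNReal.mul_div_cancel (by simpa using ht) ENNReal.ofReal_ne_top

theorem ofReal_mul_K_div_mul {t r : ℝ} (ht : 0 < t) (hr : 0 < r) (f : V) :
    ENNReal.ofReal t * (K A₀ A₁ (r * t) f / ENNReal.ofReal (r * t))
      = ENNReal.ofReal r⁻¹ * K A₀ A₁ (r * t) f := by
  conv_rhs => rw [← ofReal_mul_K_div A₀ A₁ (mul_pos hr ht) f, ← mul_assoc,
    ← ENNReal.ofReal_mul (by positivity), inv_mul_cancel_left₀ hr.ne']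

/-- The couple is separated: no nonzero element is approximated by zero in the sum of the two
spaces. -/
def IsSeparatedCouple : Prop := ∀ f : V, K A₀ A₁ 1 f = 0 → f = 0

variable {A₀ A₁}

theorem IsSeparatedCouple.eq_zero (h : IsSeparatedCouple A₀ A₁) {t : ℝ} (ht : 0 < t) {f : V}
    (hf : K A₀ A₁ t f = 0) : f = 0 := by
  refine h f ?_
  have h1 : K A₀ A₁ (max 1 t⁻¹ * t) f = 0 := by
    simpa [hf] using K_le_ofReal_mul A₀ A₁ (s := t) (le_max_left 1 t⁻¹) f
  refine le_antisymm ((K_mono A₀ A₁ f ?_).trans h1.le) zero_le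
  calc (1 : ℝ) = t⁻¹ * t := (inv_mul_cancel₀ ht.ne').symm
    _ ≤ _ := by gcongr; exact le_max_right _ _

variable (A₀ A₁) in
/-- `a t` is the first component of a decomposition of `x` that attains `K(t, x)` up to a
factor `2`. -/
def IsNearOptimal (x : V) (a : ℝ → V) : Prop :=
  ∀ t, 0 < t → A₀ (a t) ≤ 2 * K A₀ A₁ t x ∧ A₁ (x - a t) ≤ 2 * (K A₀ A₁ t x / ENNReal.ofReal t)

theorem IsSeparatedCouple.exists_isNearOptimal (h : IsSeparatedCouple A₀ A₁) {x : V}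
    (hx : K A₀ A₁ 1 x < ∞) : ∃ a, IsNearOptimal A₀ A₁ x a := by
  suffices H : ∀ t : ℝ, ∃ a : V, 0 < t → A₀ a ≤ 2 * K A₀ A₁ t x ∧
      A₁ (x - a) ≤ 2 * (K A₀ A₁ t x / ENNReal.ofReal t) from
    ⟨fun t => (H t).choose, fun t => (H t).choose_spec⟩
  intro t
  by_cases ht : 0 < t
  swap
  · exact ⟨0, fun h => absurd h ht⟩
  suffices H : ∃ a : V, A₀ a ≤ 2 * K A₀ A₁ t x ∧
      A₁ (x - a) ≤ 2 * (K A₀ A₁ t x / ENNReal.ofReal t) from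
    ⟨H.choose, fun _ => H.choose_spec⟩
  rcases eq_or_ne (K A₀ A₁ t x) 0 with h0 | h0
  · exact ⟨0, by simp [map_zero, h.eq_zero ht h0]⟩
  have h1 : K A₀ A₁ t x < 2 * K A₀ A₁ t x := by
    conv_lhs => rw [← one_mul (K A₀ A₁ t x)]
    exact (ENNReal.mul_lt_mul_iff_left h0 (K_lt_top A₀ A₁ hx t).ne).2 ENNReal.one_lt_two
  conv_lhs at h1 => rw [K]
  simp only [iInf_lt_iff] at h1
  obtain ⟨f₀, f₁, e, hlt⟩ := h1
  refine ⟨f₀, le_self_add.trans hlt.le, ?_⟩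
  rw [← e, add_sub_cancel_left, ← mul_div_assoc, ENNReal.le_div_iff_mul_le
    (Or.inl (by simpa using ht)) (Or.inl ENNReal.ofReal_ne_top), mul_comm, e]
  exact le_add_self.trans hlt.le

/-- `T` is bounded on both spaces of the couple; the constant `c` bounds the operator quasi-norms
and the constants in the two quasi-triangle inequalities. -/
structure IsBoundedOnCouple (A₀ A₁ : ExtQuasiNorm V) (T : V →ₗ[ℂ] V) (c : ℝ≥0) : Prop where
  add₀ : ∀ x y : V, A₀ (x + y) ≤ c * (A₀ x + A₀ y)
  add₁ : ∀ x y : V, A₁ (x + y) ≤ c * (A₁ x + A₁ y)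
  map₀ : ∀ x : V, A₀ (T x) ≤ c * A₀ x
  map₁ : ∀ x : V, A₁ (T x) ≤ c * A₁ x

variable {T : V →ₗ[ℂ] V} {c : ℝ≥0}

theorem sub_le_of_add_le {N : ExtQuasiNorm V} (h : ∀ x y : V, N (x + y) ≤ c * (N x + N y))
    (x y : V) : N (x - y) ≤ c * (N x + N y) := by
  simpa [sub_eq_add_neg, map_neg] using h x (-y)

theorem IsBoundedOnCouple.K_map_le (h : IsBoundedOnCouple A₀ A₁ T c) (hc : c ≠ 0) (t : ℝ) (x : V) :
    K A₀ A₁ t (T x) ≤ c * K A₀ A₁ t x := by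
  conv_rhs => rw [K]
  simp only [ENNReal.mul_iInf_of_ne (ENNReal.coe_ne_zero.2 hc) ENNReal.coe_ne_top]
  refine le_iInf fun f₀ => le_iInf fun f₁ => le_iInf fun e => ?_
  rw [← e, _root_.map_add]
  refine (K_add_le A₀ A₁ _ _ _).trans ?_
  rw [mul_add, mul_left_comm]
  gcongr
  · exact h.map₀ _
  · exact h.map₁ _

variable {x : V} {a : ℝ → V}

theorem IsNearOptimal.left_sub_le (ha : IsNearOptimal A₀ A₁ x a)
    (h : IsBoundedOnCouple A₀ A₁ T c) {s t : ℝ} (hs : 0 < s) (hst : s ≤ t) :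
    A₀ (a t - a s) ≤ 4 * c * K A₀ A₁ t x := by
  calc A₀ (a t - a s) ≤ c * (A₀ (a t) + A₀ (a s)) := sub_le_of_add_le h.add₀ _ _
    _ ≤ c * (2 * K A₀ A₁ t x + 2 * K A₀ A₁ t x) := by
        gcongr
        · exact (ha t (hs.trans_le hst)).1
        · exact (ha s hs).1.trans (by gcongr; exact K_mono A₀ A₁ x hst)
    _ = _ := by ring

theorem IsNearOptimal.right_sub_le (ha : IsNearOptimal A₀ A₁ x a)
    (h : IsBoundedOnCouple A₀ A₁ T c) {s t : ℝ} (hs : 0 < s) (hst : s ≤ t) :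
    A₁ (a t - a s) ≤ 4 * c * (K A₀ A₁ s x / ENNReal.ofReal s) := by
  calc A₁ (a t - a s) = A₁ ((x - a s) - (x - a t)) := by congr 1; abel
    _ ≤ c * (A₁ (x - a s) + A₁ (x - a t)) := sub_le_of_add_le h.add₁ _ _
    _ ≤ c * (2 * (K A₀ A₁ s x / ENNReal.ofReal s) + 2 * (K A₀ A₁ s x / ENNReal.ofReal s)) := by
        gcongr
        · exact (ha s hs).2
        · exact (ha t (hs.trans_le hst)).2.trans (mul_le_mul' le_rfl (K_div_anti A₀ A₁ hs hst x))
    _ = _ := by ring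

/-! ### The two tails of a decomposition -/

/-- If `T` has a small norm `δ` on elements that are much smaller in `A₀` than in `A₁`, then `T`
maps the part of `x` which lies in `A₀` for a small parameter `ρ` to an element with a small
K-functional. -/
theorem IsNearOptimal.K_map_left_le (ha : IsNearOptimal A₀ A₁ x a)
    (h : IsBoundedOnCouple A₀ A₁ T c) (hx : K A₀ A₁ 1 x < ∞) {δ ρ : ℝ} (hδ : 0 < δ) (hρ : 0 < ρ)
    (hT : ∀ (u : V) (m : ℝ≥0∞), m ≠ ∞ → A₀ u ≤ ENNReal.ofReal ρ * m → A₁ u ≤ m →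
      A₁ (T u) ≤ ENNReal.ofReal δ * m) {t : ℝ} (ht : 0 < t) :
    K A₀ A₁ t (T (a ρ)) ≤ 6 * c * K A₀ A₁ (δ * t) x := by
  have hs : 0 < δ * t := mul_pos hδ ht
  rcases le_or_gt ρ (δ * t) with hρs | hρs
  · calc K A₀ A₁ t (T (a ρ)) ≤ A₀ (T (a ρ)) := K_le_left ..
      _ ≤ c * A₀ (a ρ) := h.map₀ _
      _ ≤ c * (2 * K A₀ A₁ (δ * t) x) := by
          gcongr
          exact (ha ρ hρ).1.trans (by gcongr; exact K_mono A₀ A₁ x hρs)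
      _ ≤ c * (2 * K A₀ A₁ (δ * t) x) + 4 * c * K A₀ A₁ (δ * t) x := le_self_add
      _ = _ := by ring
  · set s := δ * t with hs_def
    set m : ℝ≥0∞ := 4 * c * (K A₀ A₁ s x / ENNReal.ofReal s) with hm
    have hmt : m ≠ ∞ := by
      have := (K_lt_top A₀ A₁ hx s).ne
      have : ENNReal.ofReal s ≠ 0 := by simpa using hs
      finiteness
    have h0 : A₀ (a ρ - a s) ≤ ENNReal.ofReal ρ * m := by
      refine (ha.left_sub_le h hs hρs.le).trans ?_
      rw [← ofReal_mul_K_div A₀ A₁ hρ, hm, mul_left_comm]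
      exact mul_le_mul' le_rfl (mul_le_mul' le_rfl (K_div_anti A₀ A₁ hs hρs.le x))
    have h1 := hT _ m hmt h0 (ha.right_sub_le h hs hρs.le)
    have e : T (a ρ) = T (a s) + T (a ρ - a s) := by rw [← _root_.map_add]; congr 1; abel
    calc K A₀ A₁ t (T (a ρ)) ≤ A₀ (T (a s)) + ENNReal.ofReal t * A₁ (T (a ρ - a s)) := by
          rw [e]; exact K_add_le ..
      _ ≤ c * (2 * K A₀ A₁ s x) + ENNReal.ofReal t * (ENNReal.ofReal δ * m) := by
          gcongr
          exact (h.map₀ _).trans (by gcongr; exact (ha s hs).1)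
      _ = c * (2 * K A₀ A₁ s x)
            + 4 * c * (ENNReal.ofReal s * (K A₀ A₁ s x / ENNReal.ofReal s)) := by
          rw [hm, hs_def, ENNReal.ofReal_mul hδ.le]; ring
      _ = _ := by rw [ofReal_mul_K_div A₀ A₁ hs]; ring

/-- If `T` maps elements of `A₁` into `A₀` up to an error that is small in `A₁`, then `T`
maps the part of `x` which lies in `A₁` for a large parameter `M` to an element whose
K-functional is bounded by dilates of that of `x` which are small in every interpolation norm. -/
theorem IsNearOptimal.K_map_right_le (ha : IsNearOptimal A₀ A₁ x a)
    (h : IsBoundedOnCouple A₀ A₁ T c) (hx : K A₀ A₁ 1 x < ∞) {ε r R M : ℝ} (hε : 0 < ε)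
    (hε1 : ε ≤ 1) (hr : 1 ≤ r) (hR : 0 ≤ R) (hM : 0 < M) (hRM : R * r ≤ M)
    (hT : ∀ (u : V) (m : ℝ≥0∞), m ≠ ∞ → A₀ u < ∞ → A₁ u ≤ m →
      ∃ v, A₀ v ≤ ENNReal.ofReal R * m ∧ A₁ (T u - v) ≤ ENNReal.ofReal ε * m)
    {t : ℝ} (ht : 0 < t) :
    K A₀ A₁ t (T (x - a M)) ≤ (4 * c ^ 3 + 10 * c ^ 2 + 4 * c) *
      (K A₀ A₁ (ε * r * t) x + ENNReal.ofReal r⁻¹ * K A₀ A₁ (r * t) x) := by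
  have hr0 : 0 < r := one_pos.trans_le hr
  set s := r * t with hs_def
  have hs : 0 < s := mul_pos hr0 ht
  have hts : ENNReal.ofReal t * (K A₀ A₁ s x / ENNReal.ofReal s)
      = ENNReal.ofReal r⁻¹ * K A₀ A₁ s x := ofReal_mul_K_div_mul A₀ A₁ ht hr0 x
  have hright : ENNReal.ofReal t * A₁ (T (x - a s)) ≤
      2 * c * (ENNReal.ofReal r⁻¹ * K A₀ A₁ s x) := by
    calc _ ≤ ENNReal.ofReal t * (c * (2 * (K A₀ A₁ s x / ENNReal.ofReal s))) := by
          gcongr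
          exact (h.map₁ _).trans (by gcongr; exact (ha s hs).2)
      _ = 2 * c * (ENNReal.ofReal t * (K A₀ A₁ s x / ENNReal.ofReal s)) := by ring
      _ = _ := by rw [hts]
  -- The approximation property of `T`, applied to the part of `x` between two parameters.
  have mid : ∀ s₀, 0 < s₀ → s₀ ≤ s → ∃ v,
      A₀ v ≤ 4 * c * (ENNReal.ofReal R * (K A₀ A₁ s₀ x / ENNReal.ofReal s₀)) ∧
      ENNReal.ofReal t * A₁ (T (a s - a s₀) - v + T (x - a s)) ≤
        4 * c ^ 2 * (ENNReal.ofReal (ε * t) * (K A₀ A₁ s₀ x / ENNReal.ofReal s₀))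
          + 2 * c ^ 2 * (ENNReal.ofReal r⁻¹ * K A₀ A₁ s x) := by
    intro s₀ hs₀ hs₀s
    have hfin : A₀ (a s - a s₀) < ∞ :=
      (ha.left_sub_le h hs₀ hs₀s).trans_lt
        (ENNReal.mul_lt_top (by finiteness) (K_lt_top A₀ A₁ hx s))
    have hmt : 4 * c * (K A₀ A₁ s₀ x / ENNReal.ofReal s₀) ≠ ∞ := by
      have := (K_lt_top A₀ A₁ hx s₀).ne
      have : ENNReal.ofReal s₀ ≠ 0 := by simpa using hs₀
      finiteness
    obtain ⟨v, hv0, hv1⟩ := hT _ _ hmt hfin (ha.right_sub_le h hs₀ hs₀s)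
    refine ⟨v, hv0.trans (le_of_eq (by ring)), ?_⟩
    calc _ ≤ ENNReal.ofReal t * (c * (A₁ (T (a s - a s₀) - v) + A₁ (T (x - a s)))) := by
          gcongr; exact h.add₁ _ _
      _ = ENNReal.ofReal t * c * A₁ (T (a s - a s₀) - v)
            + c * (ENNReal.ofReal t * A₁ (T (x - a s))) := by ring
      _ ≤ ENNReal.ofReal t * c * (ENNReal.ofReal ε *
              (4 * c * (K A₀ A₁ s₀ x / ENNReal.ofReal s₀)))
            + c * (2 * c * (ENNReal.ofReal r⁻¹ * K A₀ A₁ s x)) := by gcongr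
      _ = _ := by rw [ENNReal.ofReal_mul hε.le]; ring
  rcases le_or_gt s M with hsM | hsM
  · calc K A₀ A₁ t (T (x - a M)) ≤ ENNReal.ofReal t * A₁ (T (x - a M)) := K_le_right ..
      _ ≤ ENNReal.ofReal t * (c * (2 * (K A₀ A₁ s x / ENNReal.ofReal s))) := by
          gcongr
          refine (h.map₁ _).trans ?_
          gcongr
          exact (ha M hM).2.trans (mul_le_mul' le_rfl (K_div_anti A₀ A₁ hs hsM x))
      _ = 2 * c * (ENNReal.ofReal t * (K A₀ A₁ s x / ENNReal.ofReal s)) := by ring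
      _ = 2 * c * (ENNReal.ofReal r⁻¹ * K A₀ A₁ s x) := by rw [hts]
      _ ≤ (2 * c + (4 * c ^ 3 + 10 * c ^ 2 + 2 * c)) *
          (K A₀ A₁ (ε * r * t) x + ENNReal.ofReal r⁻¹ * K A₀ A₁ s x) :=
          mul_le_mul' le_self_add le_add_self
      _ = _ := by ring
  rcases le_or_gt (ε * r * t) M with hεM | hεM
  · obtain ⟨v, hv0, hv1⟩ := mid M hM hsM.le
    -- Both `R` and `ε t` are at most `M / r`.
    have hsmall : ∀ y : ℝ, y * r ≤ M → ENNReal.ofReal y * (K A₀ A₁ M x / ENNReal.ofReal M)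
        ≤ ENNReal.ofReal r⁻¹ * K A₀ A₁ s x := by
      intro y hy
      calc _ ≤ ENNReal.ofReal (r⁻¹ * M) * (K A₀ A₁ M x / ENNReal.ofReal M) := by
            gcongr
            rw [inv_mul_eq_div, le_div_iff₀ hr0]
            exact hy
        _ = ENNReal.ofReal r⁻¹ * K A₀ A₁ M x := by
            rw [ENNReal.ofReal_mul (by positivity), mul_assoc, ofReal_mul_K_div A₀ A₁ hM]
        _ ≤ _ := by gcongr; exact K_mono A₀ A₁ x hsM.le
    have e : T (x - a M) = v + (T (a s - a M) - v + T (x - a s)) := by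
      simp only [_root_.map_sub]; abel
    calc K A₀ A₁ t (T (x - a M)) ≤ A₀ v + ENNReal.ofReal t *
            A₁ (T (a s - a M) - v + T (x - a s)) := by rw [e]; exact K_add_le ..
      _ ≤ 4 * c * (ENNReal.ofReal r⁻¹ * K A₀ A₁ s x) +
            (4 * c ^ 2 * (ENNReal.ofReal r⁻¹ * K A₀ A₁ s x)
              + 2 * c ^ 2 * (ENNReal.ofReal r⁻¹ * K A₀ A₁ s x)) := by
          refine add_le_add (hv0.trans ?_) (hv1.trans ?_)
          · exact mul_le_mul' le_rfl (hsmall R hRM)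
          · exact add_le_add (mul_le_mul' le_rfl
              (hsmall (ε * t) (by linarith [mul_right_comm ε r t]))) le_rfl
      _ = (4 * c + 6 * c ^ 2) * (ENNReal.ofReal r⁻¹ * K A₀ A₁ s x) := by ring
      _ ≤ (4 * c + 6 * c ^ 2 + (4 * c ^ 3 + 4 * c ^ 2)) *
          (K A₀ A₁ (ε * r * t) x + ENNReal.ofReal r⁻¹ * K A₀ A₁ s x) :=
          mul_le_mul' le_self_add le_add_self
      _ = _ := by ring
  · set s₀ := ε * r * t with hs₀_def
    have hs₀ : 0 < s₀ := hM.trans hεM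
    have hs₀s : s₀ ≤ s := by
      rw [hs₀_def, mul_assoc]
      exact mul_le_of_le_one_left hs.le hε1
    obtain ⟨v, hv0, hv1⟩ := mid s₀ hs₀ hs₀s
    have hsmall : ∀ y : ℝ, y ≤ s₀ → ENNReal.ofReal y * (K A₀ A₁ s₀ x / ENNReal.ofReal s₀)
        ≤ K A₀ A₁ s₀ x := by
      intro y hy
      calc _ ≤ ENNReal.ofReal s₀ * (K A₀ A₁ s₀ x / ENNReal.ofReal s₀) := by gcongr
        _ = _ := ofReal_mul_K_div A₀ A₁ hs₀ x
    have e : T (x - a M) = (T (a s₀ - a M) + v) + (T (a s - a s₀) - v + T (x - a s)) := by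
      simp only [_root_.map_sub]; abel
    calc K A₀ A₁ t (T (x - a M)) ≤ A₀ (T (a s₀ - a M) + v) + ENNReal.ofReal t *
            A₁ (T (a s - a s₀) - v + T (x - a s)) := by rw [e]; exact K_add_le ..
      _ ≤ c * (c * (4 * c * K A₀ A₁ s₀ x) + 4 * c * K A₀ A₁ s₀ x) +
            (4 * c ^ 2 * K A₀ A₁ s₀ x + 2 * c ^ 2 * (ENNReal.ofReal r⁻¹ * K A₀ A₁ s x)) := by
          refine add_le_add ((h.add₀ _ _).trans ?_) (hv1.trans ?_)
          · gcongr
            · refine (h.map₀ _).trans ?_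
              gcongr
              exact ha.left_sub_le h hM hεM.le
            · refine hv0.trans ?_
              gcongr
              exact hsmall R (by nlinarith)
          · gcongr
            refine hsmall (ε * t) ?_
            rw [hs₀_def, mul_right_comm]
            exact le_mul_of_one_le_right (by positivity) hr
      _ = (4 * c ^ 3 + 8 * c ^ 2) * K A₀ A₁ s₀ x
            + 2 * c ^ 2 * (ENNReal.ofReal r⁻¹ * K A₀ A₁ s x) := by ring
      _ ≤ (4 * c ^ 3 + 8 * c ^ 2 + (2 * c ^ 2 + 4 * c)) * K A₀ A₁ s₀ x
            + (2 * c ^ 2 + (4 * c ^ 3 + 8 * c ^ 2 + 4 * c)) *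
              (ENNReal.ofReal r⁻¹ * K A₀ A₁ s x) :=
          add_le_add (mul_le_mul' le_self_add le_rfl) (mul_le_mul' le_self_add le_rfl)
      _ = _ := by ring

end Couple

end ExtQuasiNorm

/-! ### Compactness of the interpolated operator -/

namespace ExtQuasiNorm

theorem exists_enorm_eq {m : ℝ≥0∞} (hm : m ≠ ∞) : ∃ r : ℂ, ‖r‖ₑ = m := by
  refine ⟨(m.toReal : ℂ), ?_⟩
  rw [← ofReal_norm, Complex.norm_real, Real.norm_of_nonneg ENNReal.toReal_nonneg,
    ENNReal.ofReal_toReal hm]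

theorem exists_rpow_le {θ : ℝ} (hθ : 0 < θ) {e : ℝ≥0∞} (he : e ≠ 0) :
    ∃ δ : ℝ, 0 < δ ∧ δ ≤ 1 ∧ ENNReal.ofReal (δ ^ θ) ≤ e := by
  have h1 : min e 1 ≠ ∞ := (min_lt_of_right_lt ENNReal.one_lt_top).ne
  have h0 : 0 < (min e 1).toReal := ENNReal.toReal_pos (by simp [he]) h1
  have h2 : (min e 1).toReal ≤ 1 := ENNReal.toReal_le_of_le_ofReal one_pos.le (by simp)
  refine ⟨(min e 1).toReal ^ θ⁻¹, by positivity, Real.rpow_le_one h0.le h2 (by positivity), ?_⟩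
  rw [← Real.rpow_mul h0.le, inv_mul_cancel₀ hθ.ne', Real.rpow_one, ENNReal.ofReal_toReal h1]
  exact min_le_left _ _

section Couple

variable {V : Type*} [AddCommGroup V] [Module ℂ V] {A₀ A₁ : ExtQuasiNorm V}
  {T : V →ₗ[ℂ] V} {c : ℝ≥0}

/-- Every sequence bounded with respect to `N` is mapped by `T` to a sequence with a cluster point
with respect to `N`. -/
def IsSeqCompactMap (N : ExtQuasiNorm V) (T : V →ₗ[ℂ] V) : Prop :=
  ∀ (m : ℝ≥0∞) (u : ℕ → V), m ≠ ∞ → (∀ n, N (u n) ≤ m) →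
    ∃ y, ∀ ε : ℝ≥0∞, 0 < ε → ∃ᶠ n in Filter.atTop, N (T (u n) - y) < ε

/-- Images of bounded sets are totally bounded: otherwise a bounded sequence would have uniformly
separated images, contradicting the existence of a cluster point. -/
theorem IsSeqCompactMap.exists_finset_net {N : ExtQuasiNorm V} (hN : IsSeqCompactMap N T)
    {S : Set V} {m : ℝ≥0∞} (hm : m ≠ ∞) (hS : ∀ u ∈ S, N u ≤ m) {ε : ℝ≥0∞} (hε : 0 < ε) :
    ∃ F : Finset V, (∀ u ∈ F, u ∈ S) ∧ ∀ u ∈ S, ∃ u' ∈ F, N (T u - T u') < ε := by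
  by_contra! hcon
  obtain ⟨u, huS, hu⟩ := exists_seq_of_forall_finset_exists (fun u => u ∈ S)
    (fun u' u => ε ≤ N (T u - T u')) fun F hF => hcon F hF
  obtain ⟨y, hy⟩ := hN m u hm fun n => hS _ (huS n)
  obtain ⟨C, hC⟩ := N.add_le'
  obtain ⟨e, he, heε⟩ := ENNReal.exists_nnreal_pos_mul_lt
    (a := C * 2) (by finiteness) hε.ne'
  have he' : (0 : ℝ≥0∞) < e := by exact_mod_cast he
  obtain ⟨n, hn⟩ := (hy e he').exists
  obtain ⟨n', hnn', hn'⟩ := (Filter.frequently_atTop.1 (hy e he')) (n + 1)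
  refine absurd (hu n n' hnn') (not_le.2 ?_)
  calc N (T (u n') - T (u n)) = N ((T (u n') - y) + (y - T (u n))) := by congr 1; abel
    _ ≤ C * (N (T (u n') - y) + N (y - T (u n))) := hC _ _
    _ ≤ C * (e + e) := by
        rw [N.map_sub_rev y]
        gcongr
    _ = e * (C * 2) := by ring
    _ < ε := heε

/-- If `T` is compact on `A₁`, then it has a small norm on those elements of the unit ball of `A₁`
that are small in `A₀`. The statement is homogeneous in the bound `m` of the norm in `A₁`. -/
theorem IsSeqCompactMap.exists_small_of_small_left (hA : IsSeqCompactMap A₁ T)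
    (h : IsBoundedOnCouple A₀ A₁ T c) (hsep : IsSeparatedCouple A₀ A₁) {δ : ℝ} (hδ : 0 < δ) :
    ∃ ρ : ℝ, 0 < ρ ∧ ∀ (u : V) (m : ℝ≥0∞), m ≠ ∞ → A₀ u ≤ ENNReal.ofReal ρ * m → A₁ u ≤ m →
      A₁ (T u) ≤ ENNReal.ofReal δ * m := by
  obtain ⟨ρ, hρ, H⟩ : ∃ ρ : ℝ, 0 < ρ ∧ ∀ u : V, A₀ u ≤ ENNReal.ofReal ρ → A₁ u ≤ 1 →
      A₁ (T u) ≤ ENNReal.ofReal δ := by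
    by_contra! hcon
    choose u hu₀ hu₁ hu using fun n : ℕ => hcon (1 / ((n : ℝ) + 1)) Nat.one_div_pos_of_nat
    obtain ⟨y, hy⟩ := hA 1 u ENNReal.one_ne_top hu₁
    have hlim : Filter.Tendsto (fun n : ℕ => c * ENNReal.ofReal (1 / ((n : ℝ) + 1)))
        Filter.atTop (𝓝 0) := by
      have := ENNReal.Tendsto.const_mul (a := (c : ℝ≥0∞))
        (ENNReal.tendsto_ofReal tendsto_one_div_add_atTop_nhds_zero_nat)
        (Or.inr ENNReal.coe_ne_top)
      simpa using this
    -- A cluster point of `T (u n)` in `A₁` is the limit zero of `T (u n)` in `A₀`.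
    have hy0 : y = 0 := by
      refine hsep y (le_antisymm (le_of_forall_pos_le_add fun ε hε => ?_) zero_le)
      rw [zero_add]
      have hε2 : 0 < ε / 2 := ENNReal.half_pos hε.ne'
      obtain ⟨n, hn, hn'⟩ := ((hy _ hε2).and_eventually (hlim.eventually_lt_const hε2)).exists
      calc K A₀ A₁ 1 y = K A₀ A₁ 1 (T (u n) + (y - T (u n))) := by congr 1; abel
        _ ≤ A₀ (T (u n)) + ENNReal.ofReal 1 * A₁ (y - T (u n)) := K_add_le ..
        _ ≤ ε / 2 + ε / 2 := by
            rw [ENNReal.ofReal_one, one_mul, A₁.map_sub_rev y]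
            gcongr
            exact (h.map₀ _).trans ((mul_le_mul' le_rfl (hu₀ n)).trans hn'.le)
        _ = ε := ENNReal.add_halves ε
    obtain ⟨n, hn⟩ := (hy (ENNReal.ofReal δ) (by simpa using hδ)).exists
    rw [hy0, sub_zero] at hn
    exact (hu n).not_gt hn
  refine ⟨ρ, hρ, fun u m hm h₀ h₁ => ?_⟩
  rcases eq_or_ne m 0 with rfl | hm0
  · refine (h.map₁ u).trans ?_
    simp [le_antisymm h₁ zero_le]
  obtain ⟨r, hr⟩ := exists_enorm_eq (m := m⁻¹) (by simpa using hm0)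
  have := H (r • u)
    (by rw [map_smul, hr]
        calc m⁻¹ * A₀ u ≤ m⁻¹ * (ENNReal.ofReal ρ * m) := by gcongr
          _ = ENNReal.ofReal ρ * (m⁻¹ * m) := by ring
          _ = _ := by rw [ENNReal.inv_mul_cancel hm0 hm, mul_one])
    (by rw [map_smul, hr]
        calc m⁻¹ * A₁ u ≤ m⁻¹ * m := by gcongr
          _ = _ := ENNReal.inv_mul_cancel hm0 hm)
  rw [_root_.map_smul, map_smul, hr] at this
  calc A₁ (T u) = m * (m⁻¹ * A₁ (T u)) := by
        rw [← mul_assoc, ENNReal.mul_inv_cancel hm0 hm, one_mul]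
    _ ≤ m * ENNReal.ofReal δ := by gcongr
    _ = _ := mul_comm _ _

/-- If `T` is compact on `A₁`, then images of elements of `A₀ ∩ A₁` that are bounded in `A₁` are
close in `A₁` to elements bounded in `A₀`: the points of a finite net of images lie in `A₀`. -/
theorem IsSeqCompactMap.exists_approx (hA : IsSeqCompactMap A₁ T)
    (h : IsBoundedOnCouple A₀ A₁ T c) {ε : ℝ} (hε : 0 < ε) :
    ∃ R : ℝ, 0 ≤ R ∧ ∀ (u : V) (m : ℝ≥0∞), m ≠ ∞ → A₀ u < ∞ → A₁ u ≤ m →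
      ∃ v, A₀ v ≤ ENNReal.ofReal R * m ∧ A₁ (T u - v) ≤ ENNReal.ofReal ε * m := by
  obtain ⟨F, hF, hnet⟩ := hA.exists_finset_net (S := {u | A₀ u < ∞ ∧ A₁ u ≤ 1})
    ENNReal.one_ne_top (fun u hu => hu.2) (ε := ENNReal.ofReal ε) (by simpa using hε)
  have hR : F.sup (fun u => A₀ (T u)) < ∞ := by
    rw [Finset.sup_lt_iff (by simp)]
    exact fun u hu => (h.map₀ u).trans_lt (ENNReal.mul_lt_top ENNReal.coe_lt_top (hF u hu).1)
  refine ⟨(F.sup fun u => A₀ (T u)).toReal, ENNReal.toReal_nonneg, fun u m hm h₀ h₁ => ?_⟩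
  rw [ENNReal.ofReal_toReal hR.ne]
  rcases eq_or_ne m 0 with rfl | hm0
  · refine ⟨0, by simp [map_zero], ?_⟩
    rw [sub_zero]
    refine (h.map₁ u).trans ?_
    simp [le_antisymm h₁ zero_le]
  obtain ⟨r, hr⟩ := exists_enorm_eq (m := m⁻¹) (by simpa using hm0)
  have hr0 : r ≠ 0 := by
    rintro rfl
    simp [eq_comm, hm] at hr
  have hrt : ‖r⁻¹‖ₑ = m := by rw [enorm_inv hr0, hr, inv_inv]
  obtain ⟨u', hu', hlt⟩ := hnet (r • u) ⟨by
      rw [map_smul]; exact ENNReal.mul_lt_top enorm_lt_top h₀, by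
      rw [map_smul, hr]
      calc m⁻¹ * A₁ u ≤ m⁻¹ * m := by gcongr
        _ = _ := ENNReal.inv_mul_cancel hm0 hm⟩
  refine ⟨r⁻¹ • T u', ?_, ?_⟩
  · rw [map_smul, hrt, mul_comm]
    gcongr
    exact Finset.le_sup (f := fun u => A₀ (T u)) hu'
  · have e : T u - r⁻¹ • T u' = r⁻¹ • (T (r • u) - T u') := by
      rw [_root_.map_smul, smul_sub, inv_smul_smul₀ hr0]
    rw [e, map_smul, hrt, mul_comm]
    gcongr

theorem interpNorm_le_of_le {θ : ℝ} {q : ℝ≥0∞} (hq : 0 < q) {y : V} {m : ℝ≥0∞} (hm : m ≠ ∞)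
    {δ : ℝ} (hδ : 0 < δ) (h₀ : A₀ y ≤ m) (h₁ : A₁ y ≤ ENNReal.ofReal δ * m) :
    interpNorm A₀ A₁ θ q y ≤ m * (ENNReal.ofReal (δ ^ θ) *
      weightedLq θ q fun t => ENNReal.ofReal (min 1 t)) := by
  rw [interpNorm_eq_weightedLq]
  calc _ ≤ weightedLq θ q (fun t => m * ENNReal.ofReal (min 1 (δ * t))) := by
        refine weightedLq_mono hq fun t ht => ?_
        rw [ENNReal.ofReal_min, mul_min, ENNReal.ofReal_one, mul_one]
        refine le_min ((K_le_left ..).trans h₀) ((K_le_right ..).trans ?_)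
        rw [ENNReal.ofReal_mul hδ.le]
        calc _ ≤ ENNReal.ofReal t * (ENNReal.ofReal δ * m) := by gcongr
          _ = _ := by ring
    _ = m * weightedLq θ q (fun t => ENNReal.ofReal (min 1 (δ * t))) :=
        weightedLq_const_mul hq hm _
    _ ≤ _ := by
        gcongr
        exact weightedLq_comp_mul_le hq hδ fun t => ENNReal.ofReal (min 1 t)

/-- One-sided compactness, quantitative form: the image of the unit ball of the interpolation
space is totally bounded. -/
theorem IsSeqCompactMap.exists_interpNorm_net (hA : IsSeqCompactMap A₁ T)
    (h : IsBoundedOnCouple A₀ A₁ T c) (hsep : IsSeparatedCouple A₀ A₁) {θ : ℝ} (hθ₀ : 0 < θ)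
    (hθ₁ : θ < 1) {q : ℝ≥0∞} (hq : 0 < q) {ε : ℝ≥0∞} (hε : 0 < ε) :
    ∃ F : Finset V, (∀ y ∈ F, interpNorm A₀ A₁ θ q y < ∞) ∧
      ∀ x, interpNorm A₀ A₁ θ q x ≤ 1 → K A₀ A₁ 1 x < ∞ →
        ∃ y ∈ F, interpNorm A₀ A₁ θ q (T x - y) < ε := by
  obtain ⟨C, hC⟩ := exists_interpNorm_add_le A₀ A₁ θ hq
  obtain ⟨D, hD⟩ := exists_weightedLq_add_le θ hq
  obtain ⟨E, hE⟩ := exists_apply_one_le_weightedLq hθ₀ hθ₁ hq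
  set Φ := weightedLq θ q fun t => ENNReal.ofReal (min 1 t) with hΦ
  have hΦt : Φ ≠ ∞ := (weightedLq_min_one_lt_top hθ₀ hθ₁ hq).ne
  obtain ⟨e, he, heε⟩ := ENNReal.exists_nnreal_pos_mul_lt
    (a := C + 2 * C ^ 2) (by finiteness) hε.ne'
  have he0 : (e : ℝ≥0∞) ≠ 0 := by simpa using he.ne'
  -- `ρ` is so small that `T` is small on the `A₀`-part of `x` for the parameter `ρ`.
  obtain ⟨e₁, he₁, hee₁⟩ := ENNReal.exists_nnreal_pos_mul_lt (a := 6 * c) (by finiteness) he0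
  obtain ⟨δ, hδ, -, hδe⟩ := exists_rpow_le hθ₀ (e := e₁) (by simpa using he₁.ne')
  obtain ⟨ρ, hρ, hTρ⟩ := hA.exists_small_of_small_left h hsep hδ
  have hleft : ∀ x a, interpNorm A₀ A₁ θ q x ≤ 1 → K A₀ A₁ 1 x < ∞ → IsNearOptimal A₀ A₁ x a →
      interpNorm A₀ A₁ θ q (T (a ρ)) ≤ e := by
    intro x a hx hx' ha
    rw [interpNorm_eq_weightedLq] at hx ⊢
    calc _ ≤ weightedLq θ q (fun t => 6 * c * K A₀ A₁ (δ * t) x) :=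
          weightedLq_mono hq fun t ht => ha.K_map_left_le h hx' hδ hρ hTρ ht
      _ = 6 * c * weightedLq θ q (fun t => K A₀ A₁ (δ * t) x) :=
          weightedLq_const_mul hq (by finiteness) _
      _ ≤ 6 * c * (ENNReal.ofReal (δ ^ θ) * weightedLq θ q fun t => K A₀ A₁ t x) := by
          gcongr
          exact weightedLq_comp_mul_le hq hδ fun t => K A₀ A₁ t x
      _ ≤ 6 * c * (e₁ * 1) := by gcongr
      _ = e₁ * (6 * c) := by ring
      _ ≤ e := hee₁.le
  -- `M` is so large that `T` is small on the `A₁`-part of `x` for the parameter `M`. The dilation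
  -- `r = r'⁻¹` makes `r^{θ-1}` small; the approximation error `η r'` turns the other dilation
  -- into `η r' r = η`, which makes `η^θ` small.
  set G : ℝ≥0∞ := 4 * c ^ 3 + 10 * c ^ 2 + 4 * c with hG
  obtain ⟨e₂, he₂, hee₂⟩ := ENNReal.exists_nnreal_pos_mul_lt (a := G * (D * 2))
    (by finiteness) he0
  have he₂0 : (e₂ : ℝ≥0∞) ≠ 0 := by simpa using he₂.ne'
  obtain ⟨r', hr', hr'1, hre⟩ := exists_rpow_le (sub_pos.2 hθ₁) he₂0
  obtain ⟨η, hη, hη1, hηe⟩ := exists_rpow_le hθ₀ he₂0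
  set r := r'⁻¹ with hr_def
  have hr : 1 ≤ r := (one_le_inv₀ hr').2 hr'1
  have hr0 : 0 < r := one_pos.trans_le hr
  have hηr : 0 < η * r' := mul_pos hη hr'
  obtain ⟨R, hR, hTR⟩ := hA.exists_approx h hηr
  set M := max 1 (R * r) with hM_def
  have hM : 0 < M := one_pos.trans_le (le_max_left _ _)
  have hright : ∀ x a, interpNorm A₀ A₁ θ q x ≤ 1 → K A₀ A₁ 1 x < ∞ → IsNearOptimal A₀ A₁ x a →
      interpNorm A₀ A₁ θ q (T (x - a M)) ≤ e := by
    intro x a hx hx' ha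
    rw [interpNorm_eq_weightedLq] at hx ⊢
    have hm : ∀ s : ℝ, Measurable fun t => K A₀ A₁ (s * t) x := fun s =>
      (measurable_K A₀ A₁ x).comp (measurable_const_mul s)
    have hcancel : η * r' * r = η := by
      rw [mul_assoc, hr_def, mul_inv_cancel₀ hr'.ne', mul_one]
    calc _ ≤ weightedLq θ q (fun t => G *
            (K A₀ A₁ (η * t) x + ENNReal.ofReal r⁻¹ * K A₀ A₁ (r * t) x)) := by
          refine weightedLq_mono hq fun t ht => ?_
          have := ha.K_map_right_le h hx' hηr (mul_le_one₀ hη1 hr'.le hr'1) hr hR hM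
            (le_max_right _ _) hTR ht
          rwa [hcancel] at this
      _ = G * weightedLq θ q (fun t =>
            K A₀ A₁ (η * t) x + ENNReal.ofReal r⁻¹ * K A₀ A₁ (r * t) x) :=
          weightedLq_const_mul hq (by finiteness) _
      _ ≤ G * (D * (weightedLq θ q (fun t => K A₀ A₁ (η * t) x) +
            weightedLq θ q (fun t => ENNReal.ofReal r⁻¹ * K A₀ A₁ (r * t) x))) := by
          gcongr
          exact hD _ _ (hm η) ((hm r).const_mul _)
      _ ≤ G * (D * (e₂ + e₂)) := by
          gcongr
          · calc _ ≤ ENNReal.ofReal (η ^ θ) * weightedLq θ q fun t => K A₀ A₁ t x :=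
                  weightedLq_comp_mul_le hq hη fun t => K A₀ A₁ t x
              _ ≤ e₂ * 1 := by gcongr
              _ = e₂ := mul_one _
          · rw [weightedLq_const_mul hq ENNReal.ofReal_ne_top]
            calc _ ≤ ENNReal.ofReal r⁻¹ *
                    (ENNReal.ofReal (r ^ θ) * weightedLq θ q fun t => K A₀ A₁ t x) := by
                  gcongr
                  exact weightedLq_comp_mul_le hq hr0 fun t => K A₀ A₁ t x
              _ ≤ ENNReal.ofReal r⁻¹ * (ENNReal.ofReal (r ^ θ) * 1) := by gcongr
              _ = ENNReal.ofReal (r' ^ (1 - θ)) := by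
                  rw [mul_one, ← ENNReal.ofReal_mul (by positivity), hr_def, inv_inv,
                    Real.inv_rpow hr'.le, ← Real.rpow_neg hr'.le, sub_eq_add_neg,
                    Real.rpow_add hr', Real.rpow_one]
              _ ≤ e₂ := hre
      _ = e₂ * (G * (D * 2)) := by ring
      _ ≤ e := hee₂.le
  -- The middle part stays in a bounded set of `A₀ ∩ A₁`.
  obtain ⟨m, hm, hmid⟩ : ∃ m : ℝ≥0∞, m ≠ ∞ ∧ ∀ x a, interpNorm A₀ A₁ θ q x ≤ 1 →
      K A₀ A₁ 1 x < ∞ → IsNearOptimal A₀ A₁ x a →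
      A₀ (a M - a ρ) ≤ m ∧ A₁ (a M - a ρ) ≤ m := by
    have hK : ∀ t x, interpNorm A₀ A₁ θ q x ≤ 1 → K A₀ A₁ 1 x < ∞ →
        K A₀ A₁ t x ≤ ENNReal.ofReal (max 1 t) * E := by
      intro t x hx hx'
      calc K A₀ A₁ t x ≤ K A₀ A₁ (max 1 t * 1) x := by
            rw [mul_one]; exact K_mono A₀ A₁ x (le_max_right 1 t)
        _ ≤ ENNReal.ofReal (max 1 t) * K A₀ A₁ 1 x := K_le_ofReal_mul A₀ A₁ (le_max_left 1 t) x
        _ ≤ ENNReal.ofReal (max 1 t) * (E * 1) := by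
            gcongr
            exact (hE _ (K_mono A₀ A₁ x) hx'.ne).trans (by gcongr; exact hx)
        _ = _ := by rw [mul_one]
    have hρ' : ENNReal.ofReal ρ ≠ 0 := by simpa using hρ
    have hM' : ENNReal.ofReal M ≠ 0 := by simpa using hM
    refine ⟨c * (2 * (ENNReal.ofReal (max 1 M) * E) + 2 * (ENNReal.ofReal (max 1 ρ) * E)) +
      c * (2 * (ENNReal.ofReal (max 1 ρ) * E / ENNReal.ofReal ρ) +
        2 * (ENNReal.ofReal (max 1 M) * E / ENNReal.ofReal M)), by finiteness,
      fun x a hx hx' ha => ⟨?_, ?_⟩⟩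
    · refine (sub_le_of_add_le h.add₀ _ _).trans (le_trans ?_ le_self_add)
      gcongr
      · exact (ha M hM).1.trans (mul_le_mul' le_rfl (hK M x hx hx'))
      · exact (ha ρ hρ).1.trans (mul_le_mul' le_rfl (hK ρ x hx hx'))
    · have e : a M - a ρ = (x - a ρ) - (x - a M) := by abel
      rw [e]
      refine (sub_le_of_add_le h.add₁ _ _).trans (le_trans ?_ le_add_self)
      gcongr
      · exact (ha ρ hρ).2.trans (mul_le_mul' le_rfl (ENNReal.div_le_div_right (hK ρ x hx hx') _))
      · exact (ha M hM).2.trans (mul_le_mul' le_rfl (ENNReal.div_le_div_right (hK M x hx hx') _))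
  set m' : ℝ≥0∞ := c * (c * m + c * m) + 1 with hm'
  have hm't : m' ≠ ∞ := by finiteness
  obtain ⟨e₃, he₃, hee₃⟩ := ENNReal.exists_nnreal_pos_mul_lt (a := m' * Φ) (by finiteness) he0
  obtain ⟨σ, hσ, -, hσe⟩ := exists_rpow_le hθ₀ (e := e₃) (by simpa using he₃.ne')
  obtain ⟨F, hF, hnet⟩ := hA.exists_finset_net (S := {u | A₀ u ≤ m ∧ A₁ u ≤ m}) hm
    (fun u hu => hu.2) (ε := ENNReal.ofReal σ * m')
    (ENNReal.mul_pos (by simpa using hσ) (by simp [hm']))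
  classical
  refine ⟨F.image T, ?_, fun x hx hx' => ?_⟩
  · intro y hy
    obtain ⟨u, hu, rfl⟩ := Finset.mem_image.1 hy
    refine (interpNorm_le_of_le hq (m := c * m) (δ := 1) (by finiteness) one_pos ?_ ?_).trans_lt ?_
    · exact (h.map₀ u).trans (mul_le_mul' le_rfl (hF u hu).1)
    · rw [ENNReal.ofReal_one, one_mul]
      exact (h.map₁ u).trans (mul_le_mul' le_rfl (hF u hu).2)
    · exact lt_top_iff_ne_top.2 (by finiteness)
  · obtain ⟨a, ha⟩ := hsep.exists_isNearOptimal hx'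
    obtain ⟨u', hu', hlt⟩ := hnet _ (hmid x a hx hx' ha)
    refine ⟨T u', Finset.mem_image_of_mem T hu', ?_⟩
    have hmidle : interpNorm A₀ A₁ θ q (T (a M - a ρ) - T u') ≤ e := by
      refine (interpNorm_le_of_le hq hm't hσ ?_ hlt.le).trans ?_
      · refine (sub_le_of_add_le h.add₀ _ _).trans (le_trans ?_ le_self_add)
        gcongr
        · exact (h.map₀ _).trans (mul_le_mul' le_rfl (hmid x a hx hx' ha).1)
        · exact (h.map₀ _).trans (mul_le_mul' le_rfl (hF u' hu').1)
      · calc m' * (ENNReal.ofReal (σ ^ θ) * Φ) ≤ m' * (e₃ * Φ) := by gcongr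
          _ = e₃ * (m' * Φ) := by ring
          _ ≤ e := hee₃.le
    have key : T x - T u' = T (a ρ) + ((T (a M - a ρ) - T u') + T (x - a M)) := by
      simp only [_root_.map_sub]; abel
    calc interpNorm A₀ A₁ θ q (T x - T u') ≤ C * (e + C * (e + e)) := by
          rw [key]
          refine (hC _ _).trans ?_
          gcongr
          · exact hleft x a hx hx' ha
          · refine (hC _ _).trans ?_
            gcongr
            exact hright x a hx hx' ha
      _ = e * (C + 2 * C ^ 2) := by ring
      _ < ε := heε

end Couple

end ExtQuasiNorm

/-! ### Completeness of the interpolation space -/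

namespace ExtQuasiNorm

section Complete

variable {V : Type*} [AddCommGroup V] [Module ℂ V]

/-- Every Cauchy sequence for `N` converges for `N`. -/
def IsSeqComplete (N : ExtQuasiNorm V) : Prop :=
  ∀ u : ℕ → V, (∀ ε : ℝ≥0∞, 0 < ε → ∃ n₀, ∀ m ≥ n₀, ∀ n ≥ n₀, N (u m - u n) < ε) →
    ∃ g, Filter.Tendsto (fun n => N (u n - g)) Filter.atTop (𝓝 0)

theorem sum_le_of_geometric {N : ExtQuasiNorm V} {c : ℝ≥0} (hc : 1 ≤ c)
    (hN : ∀ x y : V, N (x + y) ≤ c * (N x + N y)) {d : ℕ → V}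
    (hd : ∀ n, N (d n) ≤ (2 * c : ℝ≥0∞)⁻¹ ^ n) (k m : ℕ) :
    N (∑ i ∈ Finset.range k, d (m + i)) ≤ 2 * c * (2 * c : ℝ≥0∞)⁻¹ ^ m := by
  have hc0 : (c : ℝ≥0∞) ≠ 0 := ENNReal.coe_ne_zero.2 (one_pos.trans_le hc).ne'
  have hb : (2 * c : ℝ≥0∞) * (2 * c : ℝ≥0∞)⁻¹ = 1 :=
    ENNReal.mul_inv_cancel (by simp [hc0]) (by finiteness)
  induction k generalizing m with
  | zero => simp [map_zero]
  | succ k ih =>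
    rw [Finset.sum_range_succ', add_zero]
    have e : ∑ i ∈ Finset.range k, d (m + (i + 1)) = ∑ i ∈ Finset.range k, d (m + 1 + i) :=
      Finset.sum_congr rfl fun i _ => by congr 1; ring
    rw [e]
    calc _ ≤ c * (2 * c * (2 * c : ℝ≥0∞)⁻¹ ^ (m + 1) + (2 * c : ℝ≥0∞)⁻¹ ^ m) := by
          refine (hN _ _).trans ?_
          gcongr
          · exact ih (m + 1)
          · exact hd m
      _ = c * ((2 * c * (2 * c : ℝ≥0∞)⁻¹) * (2 * c : ℝ≥0∞)⁻¹ ^ m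
            + (2 * c : ℝ≥0∞)⁻¹ ^ m) := by ring
      _ = _ := by rw [hb]; ring

/-- In a complete quasi-normed space a series converges if its terms decay fast enough, depending
on the constant in the quasi-triangle inequality. -/
theorem IsSeqComplete.exists_sum {N : ExtQuasiNorm V} (h : IsSeqComplete N) {c : ℝ≥0} (hc : 1 ≤ c)
    (hN : ∀ x y : V, N (x + y) ≤ c * (N x + N y)) {d : ℕ → V}
    (hd : ∀ n, N (d n) ≤ (2 * c : ℝ≥0∞)⁻¹ ^ n) :
    ∃ g, Filter.Tendsto (fun n => N (∑ i ∈ Finset.range n, d i - g)) Filter.atTop (𝓝 0) := by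
  refine h _ fun ε hε => ?_
  have hb : (2 * c : ℝ≥0∞)⁻¹ < 1 := by
    rw [ENNReal.inv_lt_one]
    calc (1 : ℝ≥0∞) < 2 := ENNReal.one_lt_two
      _ ≤ 2 * c := le_mul_of_one_le_right' (by exact_mod_cast hc)
  have hlim : Filter.Tendsto (fun n => 2 * c * (2 * c : ℝ≥0∞)⁻¹ ^ n) Filter.atTop (𝓝 0) := by
    simpa using ENNReal.Tendsto.const_mul (a := 2 * (c : ℝ≥0∞))
      (ENNReal.tendsto_pow_atTop_nhds_zero_of_lt_one hb) (Or.inr (by finiteness))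
  obtain ⟨n₀, hn₀⟩ := Filter.eventually_atTop.1 (hlim.eventually_lt_const hε)
  have key : ∀ n ≥ n₀, ∀ m ≥ n, N (∑ i ∈ Finset.range m, d i - ∑ i ∈ Finset.range n, d i) < ε := by
    intro n hn m hm
    obtain ⟨k, rfl⟩ := Nat.exists_eq_add_of_le hm
    rw [Finset.sum_range_add, add_sub_cancel_left]
    exact (sum_le_of_geometric hc hN hd k n).trans_lt (hn₀ n hn)
  refine ⟨n₀, fun m hm n hn => ?_⟩
  rcases le_total n m with hnm | hnm
  · exact key n hn m hnm
  · rw [N.map_sub_rev]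
    exact key m hm n hnm

variable (N : ExtQuasiNorm V)

theorem hasBasis_uniformity : (𝓤 N.Space).HasBasis (fun ε : ℝ≥0∞ => 0 < ε)
    fun ε => {z | N (z.1.1 - z.2.1) < ε} := by
  refine Filter.hasBasis_biInf_principal (s := fun ε : ℝ≥0∞ =>
    {z : N.Space × N.Space | N (z.1.1 - z.2.1) < ε}) (S := {ε | 0 < ε}) ?_ ⟨1, zero_lt_one' ℝ≥0∞⟩
  intro ε hε δ hδ
  exact ⟨min ε δ, show 0 < min ε δ from lt_min hε hδ,
    fun z (hz : N (z.1.1 - z.2.1) < min ε δ) => hz.trans_le (min_le_left _ _),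
    fun z (hz : N (z.1.1 - z.2.1) < min ε δ) => hz.trans_le (min_le_right _ _)⟩

instance : (𝓤 N.Space).IsCountablyGenerated := by
  refine (N.hasBasis_uniformity.to_hasBasis' (p' := fun _ : ℕ => True)
    (s' := fun n => {z | N (z.1.1 - z.2.1) < ((n : ℝ≥0∞) + 1)⁻¹}) (fun ε hε => ?_)
    fun n _ => ?_).isCountablyGenerated
  · obtain ⟨n, hn⟩ := ENNReal.exists_inv_nat_lt hε.ne'
    refine ⟨n, trivial, fun z hz => lt_trans (lt_of_lt_of_le hz ?_) hn⟩
    exact ENNReal.inv_le_inv.2 le_self_add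
  · exact N.hasBasis_uniformity.mem_of_mem (ENNReal.inv_pos.2 (by finiteness))

theorem hasBasis_nhds (x : N.Space) : (𝓝 x).HasBasis (fun ε : ℝ≥0∞ => 0 < ε)
    fun ε => {y | N (x.1 - y.1) < ε} :=
  nhds_basis_uniformity' N.hasBasis_uniformity

variable {A₀ A₁ : ExtQuasiNorm V}

theorem K_one_lt_top_of_mem {f : V} (hf : f ∈ A₀.space ⊔ A₁.space) : K A₀ A₁ 1 f < ∞ := by
  obtain ⟨f₀, h₀, f₁, h₁, rfl⟩ := Submodule.mem_sup.1 hf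
  refine (K_add_le A₀ A₁ 1 f₀ f₁).trans_lt ?_
  rw [ENNReal.ofReal_one, one_mul]
  exact ENNReal.add_lt_top.2 ⟨h₀, h₁⟩

/-- Real interpolation spaces of complete spaces are complete: a fast Cauchy sequence converges in
the sum of the two spaces, and Fatou's lemma for `weightedLq` upgrades the convergence. -/
theorem completeSpace_interp (h₀ : IsSeqComplete A₀) (h₁ : IsSeqComplete A₁) {θ : ℝ}
    (hθ₀ : 0 < θ) (hθ₁ : θ < 1) {q : ℝ≥0∞} (hq : 0 < q) :
    CompleteSpace (interp A₀ A₁ θ q hq).Space := by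
  obtain ⟨C₀, hC₀⟩ := A₀.add_le'
  obtain ⟨C₁, hC₁⟩ := A₁.add_le'
  obtain ⟨C, hC⟩ := exists_K_add_le A₀ A₁
  obtain ⟨E, hE⟩ := exists_apply_one_le_weightedLq hθ₀ hθ₁ hq
  set c : ℝ≥0 := C₀ + C₁ + 1 with hc_def
  have hc : 1 ≤ c := le_add_self
  have hc₀ : ∀ x y : V, A₀ (x + y) ≤ c * (A₀ x + A₀ y) := fun x y => (hC₀ x y).trans <| by
    gcongr
    rw [hc_def, add_assoc]
    exact le_self_add
  have hc₁ : ∀ x y : V, A₁ (x + y) ≤ c * (A₁ x + A₁ y) := fun x y => (hC₁ x y).trans <| by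
    gcongr
    rw [hc_def, add_right_comm, add_comm]
    exact le_self_add
  set b : ℝ≥0∞ := (2 * c)⁻¹ with hb_def
  have hb0 : 0 < b := ENNReal.inv_pos.2 (by finiteness)
  have hb1 : b < 1 := by
    rw [hb_def, ENNReal.inv_lt_one]
    calc (1 : ℝ≥0∞) < 2 := ENNReal.one_lt_two
      _ ≤ 2 * c := le_mul_of_one_le_right' (by exact_mod_cast hc)
  set B : ℕ → ℝ≥0∞ := fun n => b ^ n * (E + 1 : ℝ≥0∞)⁻¹ with hB_def
  have hB0 : ∀ n, 0 < B n := fun n =>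
    ENNReal.mul_pos (ENNReal.pow_pos hb0 n).ne' (ENNReal.inv_pos.2 (by finiteness)).ne'
  have hEB : ∀ n, E * B n ≤ b ^ n := fun n => by
    rw [hB_def]
    calc (E : ℝ≥0∞) * (b ^ n * (E + 1 : ℝ≥0∞)⁻¹) ≤ (E + 1) * (b ^ n * (E + 1 : ℝ≥0∞)⁻¹) := by
          gcongr; exact le_self_add
      _ = b ^ n * ((E + 1) * (E + 1 : ℝ≥0∞)⁻¹) := by ring
      _ = b ^ n := by rw [ENNReal.mul_inv_cancel (by simp) (by finiteness), mul_one]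
  have hBlim : Filter.Tendsto (fun n => (C + 1) * B n) Filter.atTop (𝓝 0) := by
    have := ENNReal.Tendsto.const_mul (a := ((C : ℝ≥0∞) + 1) * (E + 1 : ℝ≥0∞)⁻¹)
      (ENNReal.tendsto_pow_atTop_nhds_zero_of_lt_one hb1) (Or.inr (by finiteness))
    rw [mul_zero] at this
    refine this.congr fun n => ?_
    rw [hB_def]; ring
  refine UniformSpace.complete_of_convergent_controlled_sequences
    (fun n => {z | (interp A₀ A₁ θ q hq) (z.1.1 - z.2.1) < B n})
    (fun n => (hasBasis_uniformity _).mem_of_mem (hB0 n)) fun u hu => ?_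
  obtain ⟨v, hv⟩ : ∃ v : ℕ → V, ∀ n, v n = (u n).1 := ⟨_, fun _ => rfl⟩
  have hmem : ∀ n, v n ∈ (interp A₀ A₁ θ q hq).space := fun n => by
    rw [hv]; exact (u n).2
  have hu' : ∀ n l m, n ≤ l → n ≤ m → interpNorm A₀ A₁ θ q (v l - v m) < B n := by
    intro n l m hl hm
    rw [hv, hv]
    exact hu n l m hl hm
  have hfin : ∀ l m, K A₀ A₁ 1 (v l - v m) < ∞ := fun l m =>
    K_one_lt_top_of_mem (interp_space_le A₀ A₁ θ q hq (Submodule.sub_mem _ (hmem l) (hmem m)))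
  have hd : ∀ n, ∃ α β : V, α + β = v (n + 1) - v n ∧ A₀ α ≤ b ^ n ∧ A₁ β ≤ b ^ n := by
    intro n
    have h1 : K A₀ A₁ 1 (v (n + 1) - v n) < b ^ n := by
      rcases eq_or_ne E 0 with hE0 | hE0
      · refine ((hE _ (K_mono A₀ A₁ _) (hfin _ _).ne).trans_eq ?_).trans_lt (ENNReal.pow_pos hb0 n)
        rw [hE0, ENNReal.coe_zero, zero_mul]
      · refine (hE _ (K_mono A₀ A₁ _) (hfin _ _).ne).trans_lt (lt_of_lt_of_le ?_ (hEB n))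
        exact (ENNReal.mul_lt_mul_iff_right (by simpa using hE0) ENNReal.coe_ne_top).2
          (hu' n (n + 1) n (Nat.le_succ n) le_rfl)
    rw [K] at h1
    simp only [iInf_lt_iff, ENNReal.ofReal_one, one_mul] at h1
    obtain ⟨α, β, e, hlt⟩ := h1
    exact ⟨α, β, e, le_self_add.trans hlt.le, le_add_self.trans hlt.le⟩
  choose α β hαβ hα hβ using hd
  obtain ⟨a, ha⟩ := h₀.exists_sum hc hc₀ hα
  obtain ⟨a', ha'⟩ := h₁.exists_sum hc hc₁ hβ
  set g : V := v 0 + a + a' with hg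
  have hug : ∀ n, v n - g
      = (∑ i ∈ Finset.range n, α i - a) + (∑ i ∈ Finset.range n, β i - a') := by
    intro n
    have h1 : ∑ i ∈ Finset.range n, α i + ∑ i ∈ Finset.range n, β i = v n - v 0 := by
      rw [← Finset.sum_add_distrib, ← Finset.sum_range_sub (fun i => v i)]
      exact Finset.sum_congr rfl fun i _ => hαβ i
    have h2 : v n - g = (v n - v 0) - a - a' := by rw [hg]; abel
    rw [h2, ← h1]
    abel
  have hK : ∀ t : ℝ, Filter.Tendsto (fun m => C * K A₀ A₁ t (v m - g)) Filter.atTop (𝓝 0) := by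
    intro t
    have h1 := ENNReal.Tendsto.const_mul (a := (C : ℝ≥0∞)) (ha.add (ENNReal.Tendsto.const_mul
      (a := ENNReal.ofReal t) ha' (Or.inr ENNReal.ofReal_ne_top))) (Or.inr ENNReal.coe_ne_top)
    simp only [mul_zero, add_zero] at h1
    refine tendsto_of_tendsto_of_tendsto_of_le_of_le tendsto_const_nhds h1
      (fun _ => zero_le) fun m => ?_
    beta_reduce
    rw [hug m]
    gcongr
    exact K_add_le ..
  have hlim : ∀ k n, k ≤ n → interpNorm A₀ A₁ θ q (v n - g) ≤ C * B k := by
    intro k n hkn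
    rw [interpNorm_eq_weightedLq]
    refine weightedLq_le_of_le_liminf hq
      (l := fun m t => C * K A₀ A₁ t (v n - v m))
      (fun m => (measurable_K A₀ A₁ _).const_mul _) (fun t ht => ?_) ?_
    · rw [← ENNReal.liminf_add_of_right_tendsto_zero (hK t)]
      refine Filter.le_liminf_of_le (by isBoundedDefault) (Filter.Eventually.of_forall fun m => ?_)
      have e : v n - g = (v n - v m) + (v m - g) := by abel
      simp only [Pi.add_apply]
      rw [e, ← mul_add]
      exact hC t _ _
    · filter_upwards [Filter.eventually_ge_atTop k] with m hm
      rw [weightedLq_const_mul hq ENNReal.coe_ne_top]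
      gcongr
      exact (hu' k n m hkn hm).le
  have hgmem : g ∈ (interp A₀ A₁ θ q hq).space := by
    have h1 : v 0 - g ∈ (interp A₀ A₁ θ q hq).space :=
      (hlim 0 0 le_rfl).trans_lt (lt_top_iff_ne_top.2 (by
        have : (E : ℝ≥0∞) + 1 ≠ 0 := by simp
        rw [hB_def]
        finiteness))
    have h2 := Submodule.sub_mem _ (hmem 0) h1
    rwa [sub_sub_cancel] at h2
  refine ⟨⟨g, hgmem⟩, (hasBasis_nhds _ _).tendsto_right_iff.2 fun ε hε => ?_⟩
  obtain ⟨k, hk⟩ := (hBlim.eventually_lt_const hε).exists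
  filter_upwards [Filter.eventually_ge_atTop k] with n hn
  rw [map_sub_rev, ← hv]
  refine lt_of_le_of_lt ((hlim k n hn).trans ?_) hk
  gcongr
  exact le_self_add

/-! ### One-sided compactness for complete couples -/

/-- Compactness on `{x | N x < ∞}` in terms of a linear extension of the operator to `V`. -/
theorem IsCompactOn.isSeqCompactMap {N : ExtQuasiNorm V} {S : Submodule ℂ V} {T : S →ₗ[ℂ] S}
    {hN : N.space ≤ S} (h : N.IsCompactOn T hN) {T' : V →ₗ[ℂ] V}
    (hT' : ∀ x : S, T' x = T x) : IsSeqCompactMap N T' := by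
  obtain ⟨hT, Q, hQ, hQ0⟩ := h
  obtain ⟨δ, hδ, hδQ⟩ := (N.hasBasis_nhds 0).mem_iff.1 hQ0
  intro m u hm hu
  obtain ⟨e, he, heδ⟩ := ENNReal.exists_nnreal_pos_mul_lt hm hδ.ne'
  have he0 : (e : ℝ≥0∞) ≠ 0 := by simpa using he.ne'
  obtain ⟨r, hr⟩ := exists_enorm_eq (m := (e : ℝ≥0∞)) ENNReal.coe_ne_top
  have hr0 : r ≠ 0 := by
    rintro rfl
    simp [eq_comm, he.ne'] at hr
  have hru : ∀ n, N (r • u n) < δ := fun n => by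
    rw [map_smul, hr]
    exact (mul_le_mul' le_rfl (hu n)).trans_lt heδ
  set w : ℕ → N.Space := fun n =>
    N.restrict T hN hT ⟨r • u n, N.space.smul_mem r ((hu n).trans_lt (lt_top_iff_ne_top.2 hm))⟩
    with hw
  have hwT : ∀ n, (w n).1 = r • T' (u n) := fun n => by
    rw [← _root_.map_smul]
    exact (hT' ⟨r • u n, _⟩).symm
  obtain ⟨y, -, hy⟩ := hQ.exists_mapClusterPt (f := Filter.atTop) (u := w)
    (Filter.le_principal_iff.2 (Filter.mem_map.2 (Filter.Eventually.of_forall fun n =>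
      hδQ (show N ((0 : V) - r • u n) < δ by rw [map_sub_rev, sub_zero]; exact hru n))))
  refine ⟨r⁻¹ • y.1, fun ε hε => ?_⟩
  have hfreq := (mapClusterPt_iff_frequently.1 hy) _
    ((N.hasBasis_nhds y).mem_of_mem (ENNReal.mul_pos he0 hε.ne'))
  refine hfreq.mono fun n (hn : N (y.1 - (w n).1) < e * ε) => ?_
  have e1 : y.1 - (w n).1 = r • (r⁻¹ • y.1 - T' (u n)) := by
    rw [smul_sub, smul_inv_smul₀ hr0, hwT]
  rw [e1, map_smul, hr, map_sub_rev] at hn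
  exact lt_of_mul_lt_mul_left' hn

theorem IsBoundedOn.exists_map_le {N : ExtQuasiNorm V} {S : Submodule ℂ V} {T : S →ₗ[ℂ] S}
    {hN : N.space ≤ S} (h : N.IsBoundedOn T hN) {T' : V →ₗ[ℂ] V}
    (hT' : ∀ x : S, T' x = T x) : ∃ C : ℝ≥0, ∀ c : ℝ≥0, C + 1 ≤ c → ∀ x, N (T' x) ≤ c * N x := by
  obtain ⟨hT, C, hC⟩ := h
  refine ⟨C, fun c hc x => ?_⟩
  by_cases hx : N x < ∞
  · have h1 : T' x = (N.restrict T hN hT ⟨x, hx⟩).1 := hT' ⟨x, hN hx⟩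
    rw [h1]
    refine (hC ⟨x, hx⟩).trans ?_
    gcongr
    exact le_self_add.trans hc
  · rw [not_lt_top_iff.1 hx, ENNReal.mul_top]
    · exact le_top
    · have : 0 < c := one_pos.trans_le (le_add_self.trans hc)
      simpa using this.ne'

/-- One-sided compactness for the real method: on a separated couple of complete quasi-normed
spaces, an operator that is bounded on both spaces and compact on the second one is compact on all
real interpolation spaces. -/
theorem isCompactOn_interp (h₀ : IsSeqComplete A₀) (h₁ : IsSeqComplete A₁)
    (hsep : IsSeparatedCouple A₀ A₁)
    (T : ↥(A₀.space ⊔ A₁.space) →ₗ[ℂ] ↥(A₀.space ⊔ A₁.space))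
    (hT₀ : A₀.IsBoundedOn T le_sup_left) (hT₁ : A₁.IsBoundedOn T le_sup_right)
    (hTc : A₁.IsCompactOn T le_sup_right) {θ : ℝ} (hθ₀ : 0 < θ) (hθ₁ : θ < 1) {q : ℝ≥0∞}
    (hq : 0 < q) :
    (interp A₀ A₁ θ q hq).IsCompactOn T (interp_space_le A₀ A₁ θ q hq) := by
  obtain ⟨T', hT'⟩ := LinearMap.exists_extend ((A₀.space ⊔ A₁.space).subtype ∘ₗ T)
  replace hT' : ∀ x : ↥(A₀.space ⊔ A₁.space), T' x = T x := fun x => LinearMap.congr_fun hT' x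
  obtain ⟨C₀, hC₀⟩ := A₀.add_le'
  obtain ⟨C₁, hC₁⟩ := A₁.add_le'
  obtain ⟨D₀, hD₀⟩ := hT₀.exists_map_le hT'
  obtain ⟨D₁, hD₁⟩ := hT₁.exists_map_le hT'
  obtain ⟨c, hc⟩ : ∃ c : ℝ≥0, IsBoundedOnCouple A₀ A₁ T' c ∧ c ≠ 0 := by
    have hle : ∀ {x : ℝ≥0}, x ≤ C₀ + C₁ + (D₀ + 1) + (D₁ + 1) →
        (x : ℝ≥0∞) ≤ (C₀ + C₁ + (D₀ + 1) + (D₁ + 1) : ℝ≥0) := fun h => by exact_mod_cast h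
    refine ⟨C₀ + C₁ + (D₀ + 1) + (D₁ + 1), ⟨fun x y => (hC₀ x y).trans ?_,
      fun x y => (hC₁ x y).trans ?_, hD₀ _ ?_, hD₁ _ ?_⟩, ?_⟩
    · exact mul_le_mul' (hle (by rw [add_assoc, add_assoc]; exact le_self_add)) le_rfl
    · exact mul_le_mul' (hle (by rw [add_comm C₀, add_assoc, add_assoc]; exact le_self_add)) le_rfl
    · rw [add_right_comm]; exact le_add_self
    · exact le_add_self
    · positivity
  have hA := hTc.isSeqCompactMap hT'
  have hmaps : (interp A₀ A₁ θ q hq).MapsSpace T (interp_space_le A₀ A₁ θ q hq) := by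
    intro x
    rw [← hT']
    change interpNorm A₀ A₁ θ q (T' x.1) < ∞
    calc interpNorm A₀ A₁ θ q (T' x.1) ≤ c * interpNorm A₀ A₁ θ q x.1 := by
          rw [interpNorm_eq_weightedLq, interpNorm_eq_weightedLq,
            ← weightedLq_const_mul hq ENNReal.coe_ne_top]
          exact weightedLq_mono hq fun t _ => hc.1.K_map_le hc.2 t x.1
      _ < ∞ := ENNReal.mul_lt_top ENNReal.coe_lt_top x.2
  have := completeSpace_interp h₀ h₁ hθ₀ hθ₁ hq
  set N := interp A₀ A₁ θ q hq with hN
  have hball : {x : N.Space | N x.1 < 1} ∈ 𝓝 (0 : N.Space) := by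
    refine Filter.mem_of_superset ((N.hasBasis_nhds 0).mem_of_mem one_pos) fun x hx => ?_
    have hx' : N ((0 : V) - x.1) < 1 := hx
    rwa [map_sub_rev, sub_zero] at hx'
  refine ⟨hmaps, closure (N.restrict T _ hmaps '' {x | N x.1 < 1}), ?_, Filter.mem_of_superset hball
    fun x hx => subset_closure ⟨x, hx, rfl⟩⟩
  refine TotallyBounded.isCompact_of_isClosed (TotallyBounded.closure ?_) isClosed_closure
  rw [N.hasBasis_uniformity.totallyBounded_iff]
  intro ε hε
  obtain ⟨F, hF, hnet⟩ := hA.exists_interpNorm_net hc.1 hsep hθ₀ hθ₁ hq hε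
  refine ⟨(fun x : N.Space => x.1) ⁻¹' F, F.finite_toSet.preimage
    (fun x _ y _ h => Subtype.ext h), ?_⟩
  rintro - ⟨x, hx, rfl⟩
  obtain ⟨y, hy, hlt⟩ := hnet x.1 (le_of_lt hx)
    (K_one_lt_top_of_mem (interp_space_le A₀ A₁ θ q hq x.2))
  refine mem_iUnion₂.2 ⟨⟨y, hF y hy⟩, hy, ?_⟩
  rw [hT' ⟨x.1, interp_space_le A₀ A₁ θ q hq x.2⟩] at hlt
  exact hlt

end Complete

end ExtQuasiNorm

/-! ### Hardy spaces: growth in the disc -/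

/-- Normalized Lebesgue measure on the parameter interval of the circle. -/
noncomputable def circleParamMeasure : Measure ℝ :=
  ENNReal.ofReal (2 * Real.pi)⁻¹ • volume.restrict (Ioc 0 (2 * Real.pi))

instance : IsProbabilityMeasure circleParamMeasure := by
  refine ⟨?_⟩
  rw [circleParamMeasure, Measure.smul_apply, Measure.restrict_apply_univ, Real.volume_Ioc,
    sub_zero, smul_eq_mul, ← ENNReal.ofReal_mul (by positivity),
    inv_mul_cancel₀ (by positivity), ENNReal.ofReal_one]

theorem circleMean_eq_lintegral (p : ℝ) (r : Ioo (0 : ℝ) 1) (f : Hol) :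
    circleMean p r f = ∫⁻ t, ‖(f : 𝔻 → ℂ) (circlePoint r t)‖ₑ ^ p ∂circleParamMeasure := by
  rw [circleParamMeasure, lintegral_smul_measure, smul_eq_mul, circleMean]

theorem hardyNorm_le_iff {p : ℝ} (hp : 0 < p) (f : Hol) (A : ℝ≥0∞) :
    hardyNorm p f ≤ A ↔ ∀ r, circleMean p r f ≤ A ^ p := by
  rw [hardyNorm, one_div, ENNReal.rpow_inv_le_iff hp, iSup_le_iff]

theorem hardyNorm_mono {p q : ℝ} (hp : 0 < p) (hpq : p ≤ q) (f : Hol) :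
    hardyNorm p f ≤ hardyNorm q f := by
  have hq : 0 < q := hp.trans_le hpq
  rw [hardyNorm_le_iff hp]
  intro r
  have h1 := eLpNorm'_le_eLpNorm'_of_exponent_le hp hpq circleParamMeasure
    (continuous_comp_circlePoint f r).aestronglyMeasurable
  simp only [eLpNorm', ← circleMean_eq_lintegral] at h1
  rw [one_div, ENNReal.rpow_inv_le_iff hp] at h1
  refine h1.trans ?_
  gcongr
  rw [one_div, ENNReal.rpow_inv_le_iff hq]
  exact (hardyNorm_le_iff hq f _).1 le_rfl r

/-- Growth of a holomorphic function with bounded `p`-means, `p ≤ 1`. At a point where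
`(R - |z|) |g(z)|^p` is maximal, Cauchy's formula on a circle halfway to the boundary bounds
`|g(z)|` by the mean of `|g|^{1-p} |g|^p`, in which the first factor is controlled by `|g(z)|`
itself. -/
theorem mul_norm_rpow_le_of_circleMean_le {p : ℝ} (hp : 0 < p) (hp1 : p ≤ 1) {g : ℂ → ℂ}
    (hg : DifferentiableOn ℂ g (Metric.ball 0 1)) {A : ℝ}
    (hA : ∀ ρ : ℝ, 0 < ρ → ρ < 1 →
      (2 * Real.pi)⁻¹ * ∫ t in (0 : ℝ)..2 * Real.pi, ‖g (circleMap 0 ρ t)‖ ^ p ≤ A)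
    {R : ℝ} (hR : 0 < R) (hR1 : R < 1) {z : ℂ} (hz : ‖z‖ ≤ R) :
    (R - ‖z‖) * ‖g z‖ ^ p ≤ 2 ^ (1 / p) * A := by
  have hsub : Metric.closedBall (0 : ℂ) R ⊆ Metric.ball 0 1 := Metric.closedBall_subset_ball hR1
  have hcont : ContinuousOn (fun z => (R - ‖z‖) * ‖g z‖ ^ p) (Metric.closedBall 0 R) :=
    (continuousOn_const.sub continuousOn_id.norm).mul
      ((hg.continuousOn.mono hsub).norm.rpow_const fun _ _ => Or.inr hp.le)
  obtain ⟨z₀, hz₀, hmax⟩ := (isCompact_closedBall (0 : ℂ) R).exists_isMaxOn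
    ⟨0, by simpa using hR.le⟩ hcont
  refine (hmax (show z ∈ Metric.closedBall 0 R by simpa using hz)).trans ?_
  beta_reduce
  have hA0 : 0 ≤ A := by
    refine le_trans ?_ (hA R hR hR1)
    have : 0 ≤ ∫ t in (0 : ℝ)..2 * Real.pi, ‖g (circleMap 0 R t)‖ ^ p :=
      intervalIntegral.integral_nonneg (by positivity) fun t _ => by positivity
    positivity
  have hz₀R : ‖z₀‖ ≤ R := by simpa using hz₀
  set x := ‖g z₀‖ with hx
  rcases eq_or_lt_of_le (norm_nonneg (g z₀)) with hx0 | hx0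
  · rw [hx, ← hx0, Real.zero_rpow hp.ne', mul_zero]
    positivity
  rcases eq_or_lt_of_le hz₀R with hd0 | hd0
  · rw [hd0, sub_self, zero_mul]
    positivity
  set d := R - ‖z₀‖ with hd
  have hdpos : 0 < d := sub_pos.2 hd0
  set ρ := ‖z₀‖ + d / 2 with hρ
  have hρ0 : 0 < ρ := by positivity
  have hρR : ρ < R := by rw [hρ, hd]; linarith
  have hρ1 : ρ < 1 := hρR.trans hR1
  set M := 2 ^ (1 / p) * x with hM
  have hM0 : 0 ≤ M := by positivity
  have hnorm : ∀ t, ‖circleMap 0 ρ t‖ = ρ := fun t => by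
    rw [norm_circleMap_zero, abs_of_pos hρ0]
  have hMbound : ∀ t, ‖g (circleMap 0 ρ t)‖ ≤ M := by
    intro t
    have h1 : (R - ‖circleMap 0 ρ t‖) * ‖g (circleMap 0 ρ t)‖ ^ p ≤ d * x ^ p :=
      hmax (show circleMap 0 ρ t ∈ Metric.closedBall 0 R by
        rw [mem_closedBall_zero_iff, hnorm]; exact hρR.le)
    rw [hnorm, show R - ρ = d / 2 by rw [hρ, hd]; ring] at h1
    have h2 : ‖g (circleMap 0 ρ t)‖ ^ p ≤ M ^ p := by
      rw [hM, Real.mul_rpow (by positivity) hx0.le, ← Real.rpow_mul (by norm_num),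
        one_div_mul_cancel hp.ne', Real.rpow_one]
      nlinarith
    exact (Real.rpow_le_rpow_iff (norm_nonneg _) hM0 hp).1 h2
  have hcircle : Continuous fun t => g (circleMap 0 ρ t) :=
    hg.continuousOn.comp_continuous (continuous_circleMap 0 ρ) fun t => by
      rw [mem_ball_zero_iff, hnorm]; exact hρ1
  have hint : IntervalIntegrable (fun t => 2 / d * M ^ (1 - p) * ‖g (circleMap 0 ρ t)‖ ^ p)
      volume 0 (2 * Real.pi) :=
    (continuous_const.mul (hcircle.norm.rpow_const fun _ => Or.inr hp.le)).intervalIntegrable _ _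
  have hcauchy := (hg.mono (Metric.closedBall_subset_ball hρ1)).circleIntegral_sub_inv_smul
    (show z₀ ∈ Metric.ball 0 ρ by rw [mem_ball_zero_iff, hρ]; linarith)
  have hbound : ‖∮ w in C(0, ρ), (w - z₀)⁻¹ • g w‖
      ≤ ∫ t in (0 : ℝ)..2 * Real.pi, 2 / d * M ^ (1 - p) * ‖g (circleMap 0 ρ t)‖ ^ p := by
    refine intervalIntegral.norm_integral_le_of_norm_le (by positivity)
      (Filter.Eventually.of_forall fun t _ => ?_) hint
    set w := circleMap 0 ρ t with hw
    have hdist : d / 2 ≤ ‖w - z₀‖ := by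
      have h1 := norm_sub_norm_le w z₀
      rw [hw, hnorm, ← hw] at h1
      linarith
    have hgw : ‖g w‖ ≤ M ^ (1 - p) * ‖g w‖ ^ p := by
      rcases eq_or_lt_of_le (norm_nonneg (g w)) with h0 | h0
      · rw [← h0]; positivity
      · calc ‖g w‖ = ‖g w‖ ^ (1 - p) * ‖g w‖ ^ p := by
              rw [← Real.rpow_add h0, sub_add_cancel, Real.rpow_one]
          _ ≤ _ := by
              gcongr
              exact hMbound t
    rw [norm_smul, norm_smul, norm_inv, deriv_circleMap, norm_mul, norm_I, mul_one, hnorm]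
    calc ρ * (‖w - z₀‖⁻¹ * ‖g w‖) ≤ 1 * ((d / 2)⁻¹ * (M ^ (1 - p) * ‖g w‖ ^ p)) := by gcongr
      _ = _ := by rw [inv_div]; ring
  have hfinal : x ≤ 2 / d * M ^ (1 - p) * A := by
    rw [hcauchy, norm_smul, intervalIntegral.integral_const_mul] at hbound
    have h2π : ‖(2 * Real.pi * I : ℂ)‖ = 2 * Real.pi := by
      simp [abs_of_pos Real.pi_pos]
    rw [h2π] at hbound
    have hpi : 0 < 2 * Real.pi := by positivity
    have h1 := hA ρ hρ0 hρ1
    rw [inv_mul_le_iff₀ hpi] at h1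
    have h2 : 0 ≤ 2 / d * M ^ (1 - p) := by positivity
    have h3 := hbound.trans (mul_le_mul_of_nonneg_left h1 h2)
    have h4 : 2 * Real.pi * x ≤ 2 * Real.pi * (2 / d * M ^ (1 - p) * A) := by linarith
    exact le_of_mul_le_mul_left h4 hpi
  have hMp : M ^ (1 - p) = 2 ^ (1 / p) / 2 * x ^ (1 - p) := by
    rw [hM, Real.mul_rpow (by positivity) hx0.le, ← Real.rpow_mul (by norm_num), mul_sub,
      one_div_mul_cancel hp.ne', mul_one, Real.rpow_sub_one (by norm_num)]
  have hxp : x ^ (1 - p) * x ^ p = x := by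
    rw [← Real.rpow_add hx0, sub_add_cancel, Real.rpow_one]
  have hxpos : 0 < x ^ (1 - p) := Real.rpow_pos_of_pos hx0 _
  refine le_of_mul_le_mul_left ?_ hxpos
  calc x ^ (1 - p) * (d * x ^ p) = d * x := by rw [← mul_left_comm, hxp]
    _ ≤ d * (2 / d * M ^ (1 - p) * A) := by gcongr
    _ = x ^ (1 - p) * (2 ^ (1 / p) * A) := by rw [hMp]; field_simp

theorem ofReal_circleAverage_eq_circleMean {p : ℝ} (hp : 0 < p) (f : Hol) {g : ℂ → ℂ}
    (hfg : ∀ z : 𝔻, (f : 𝔻 → ℂ) z = g z) (r : Ioo (0 : ℝ) 1) :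
    ENNReal.ofReal ((2 * Real.pi)⁻¹ * ∫ t in (0 : ℝ)..2 * Real.pi, ‖g (circleMap 0 r t)‖ ^ p)
      = circleMean p r f := by
  have hfg' : ∀ t, (f : 𝔻 → ℂ) (circlePoint r t) = g (circleMap 0 r t) := fun t => hfg _
  have hc : Continuous fun t => ‖(f : 𝔻 → ℂ) (circlePoint r t)‖ ^ p :=
    (continuous_comp_circlePoint f r).norm.rpow_const fun _ => Or.inr hp.le
  simp only [← hfg']
  rw [ENNReal.ofReal_mul (by positivity), intervalIntegral.integral_of_le (by positivity),
    ofReal_integral_eq_lintegral_ofReal (hc.integrableOn_Ioc)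
      (Filter.Eventually.of_forall fun t => by positivity), circleMean]
  congr 1
  refine lintegral_congr fun t => ?_
  rw [← ENNReal.ofReal_rpow_of_nonneg (norm_nonneg _) hp.le, ofReal_norm]

/-- Point evaluations are bounded on Hardy spaces, uniformly on compact subsets of the disc. -/
theorem exists_enorm_apply_le_hardyNorm {p : ℝ} (hp : 0 < p) {R : ℝ} (hR : R < 1) :
    ∃ C : ℝ≥0, ∀ (f : Hol) (z : 𝔻), ‖(z : ℂ)‖ ≤ R → ‖(f : 𝔻 → ℂ) z‖ₑ ≤ C * hardyNorm p f := by
  wlog hp1 : p ≤ 1 generalizing p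
  · obtain ⟨C, hC⟩ := this one_pos le_rfl
    refine ⟨C, fun f z hz => (hC f z hz).trans ?_⟩
    gcongr
    exact hardyNorm_mono one_pos (le_of_not_ge hp1) f
  wlog hR0 : 0 ≤ R generalizing R
  · obtain ⟨C, hC⟩ := this one_half_lt_one (by norm_num)
    exact ⟨C, fun f z hz => hC f z (hz.trans (by linarith))⟩
  set D : ℝ := 2 ^ (1 / p) / ((1 - R) / 2) with hD
  have h1R : 0 < (1 - R) / 2 := by linarith
  have hD0 : 0 < D := by positivity
  refine ⟨(D ^ (1 / p)).toNNReal, fun f z hz => ?_⟩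
  rw [← ENNReal.ofReal]
  have hDp : 0 < D ^ (1 / p) := by positivity
  rcases eq_or_ne (hardyNorm p f) ∞ with hf | hf
  · rw [hf, ENNReal.mul_top (by simpa using hDp)]
    exact le_top
  obtain ⟨g, hg, hfg⟩ := f.2
  set A := (hardyNorm p f).toReal with hA
  have hA0 : 0 ≤ A := ENNReal.toReal_nonneg
  have hmean : ∀ ρ : ℝ, 0 < ρ → ρ < 1 →
      (2 * Real.pi)⁻¹ * ∫ t in (0 : ℝ)..2 * Real.pi, ‖g (circleMap 0 ρ t)‖ ^ p ≤ A ^ p := by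
    intro ρ hρ0 hρ1
    rw [← ENNReal.ofReal_le_ofReal_iff (by positivity),
      ofReal_circleAverage_eq_circleMean hp f hfg ⟨ρ, hρ0, hρ1⟩,
      ← ENNReal.ofReal_rpow_of_nonneg hA0 hp.le, hA, ENNReal.ofReal_toReal hf]
    exact (hardyNorm_le_iff hp f _).1 le_rfl _
  have h1 := mul_norm_rpow_le_of_circleMean_le hp hp1 hg hmean
    (show 0 < (1 + R) / 2 by linarith) (by linarith) (show ‖(z : ℂ)‖ ≤ (1 + R) / 2 by linarith)
  have h2 : ‖g z‖ ^ p ≤ D * A ^ p := by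
    rw [hD, div_mul_eq_mul_div, le_div_iff₀ h1R, mul_comm]
    refine le_trans ?_ h1
    gcongr
    linarith
  have h3 : ‖g z‖ ≤ D ^ (1 / p) * A := by
    refine (Real.rpow_le_rpow_iff (norm_nonneg _) (by positivity) hp).1 ?_
    rwa [Real.mul_rpow (by positivity) hA0, ← Real.rpow_mul hD0.le, one_div_mul_cancel hp.ne',
      Real.rpow_one]
  rw [hfg, ← ofReal_norm, ← ENNReal.ofReal_toReal hf, ← ENNReal.ofReal_mul (by positivity)]
  exact ENNReal.ofReal_le_ofReal h3

/-! ### Hardy spaces: completeness and separation -/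

theorem isSeparatedCouple_hardy {p₀ p₁ : ℝ} (hp₀ : 0 < p₀) (hp₁ : 0 < p₁) :
    ExtQuasiNorm.IsSeparatedCouple (hardy p₀ hp₀) (hardy p₁ hp₁) := by
  intro f hf
  refine Subtype.ext (funext fun z => ?_)
  obtain ⟨C₀, h₀⟩ := exists_enorm_apply_le_hardyNorm hp₀ z.norm_lt_one
  obtain ⟨C₁, h₁⟩ := exists_enorm_apply_le_hardyNorm hp₁ z.norm_lt_one
  have hC : ((C₀ + C₁ + 1 : ℝ≥0) : ℝ≥0∞) ≠ 0 := by simp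
  have h : ‖(f : 𝔻 → ℂ) z‖ₑ ≤
      (C₀ + C₁ + 1 : ℝ≥0) * ExtQuasiNorm.K (hardy p₀ hp₀) (hardy p₁ hp₁) 1 f := by
    simp only [ExtQuasiNorm.K, ENNReal.mul_iInf_of_ne hC ENNReal.coe_ne_top]
    refine le_iInf fun f₀ => le_iInf fun f₁ => le_iInf fun e => ?_
    rw [← e, ENNReal.ofReal_one, one_mul, mul_add]
    refine (enorm_add_le ((f₀ : 𝔻 → ℂ) z) ((f₁ : 𝔻 → ℂ) z)).trans (add_le_add ?_ ?_)
    · refine (h₀ f₀ z le_rfl).trans (mul_le_mul' ?_ le_rfl)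
      rw [add_assoc]
      exact_mod_cast le_self_add
    · refine (h₁ f₁ z le_rfl).trans (mul_le_mul' ?_ le_rfl)
      rw [add_right_comm]
      exact_mod_cast le_add_self
  rw [hf, mul_zero] at h
  simpa using h

theorem isSeqComplete_hardy {p : ℝ} (hp : 0 < p) : ExtQuasiNorm.IsSeqComplete (hardy p hp) := by
  intro u hu
  replace hu : ∀ ε : ℝ≥0∞, 0 < ε → ∃ n₀, ∀ m ≥ n₀, ∀ n ≥ n₀, hardyNorm p (u m - u n) < ε := hu
  -- The sequence is uniformly Cauchy on compact subsets of the disc.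
  have hcauchy : ∀ R < (1 : ℝ), ∀ ε : ℝ, 0 < ε → ∃ n₀, ∀ m ≥ n₀, ∀ n ≥ n₀, ∀ z : 𝔻,
      ‖(z : ℂ)‖ ≤ R → dist ((u m : 𝔻 → ℂ) z) ((u n : 𝔻 → ℂ) z) < ε := by
    intro R hR ε hε
    obtain ⟨C, hC⟩ := exists_enorm_apply_le_hardyNorm hp hR
    obtain ⟨e, he, heε⟩ := ENNReal.exists_nnreal_pos_mul_lt (a := (C : ℝ≥0∞))
      ENNReal.coe_ne_top (b := ENNReal.ofReal ε) (by simpa using hε)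
    obtain ⟨n₀, h⟩ := hu e (by exact_mod_cast he)
    refine ⟨n₀, fun m hm n hn z hz => ?_⟩
    have h1 : ‖(u m : 𝔻 → ℂ) z - (u n : 𝔻 → ℂ) z‖ₑ < ENNReal.ofReal ε :=
      calc _ ≤ C * hardyNorm p (u m - u n) := hC (u m - u n) z hz
        _ ≤ C * e := by gcongr; exact (h m hm n hn).le
        _ = e * C := mul_comm _ _
        _ < _ := heε
    rwa [← ofReal_norm, ENNReal.ofReal_lt_ofReal_iff hε, ← dist_eq_norm] at h1
  have hptw : ∀ z : 𝔻, ∃ w : ℂ, Filter.Tendsto (fun n => (u n : 𝔻 → ℂ) z) Filter.atTop (𝓝 w) := by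
    intro z
    refine cauchySeq_tendsto_of_complete (Metric.cauchySeq_iff.2 fun ε hε => ?_)
    obtain ⟨n₀, h⟩ := hcauchy _ z.norm_lt_one ε hε
    exact ⟨n₀, fun m hm n hn => h m hm n hn z le_rfl⟩
  choose G hG using hptw
  choose v hv hvu using fun n => (u n).2
  set F : ℂ → ℂ := fun w => if h : ‖w‖ < 1 then G (UnitDisc.mk w h) else 0 with hF
  have hFG : ∀ z : 𝔻, G z = F z := fun z => by
    simp only [hF, z.norm_lt_one, dif_pos, UnitDisc.mk_coe]
  have hunif : TendstoLocallyUniformlyOn v F Filter.atTop (Metric.ball 0 1) := by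
    rw [Metric.tendstoLocallyUniformlyOn_iff]
    intro ε hε x hx
    rw [mem_ball_zero_iff] at hx
    obtain ⟨R, hxR, hR⟩ := exists_between hx
    obtain ⟨n₀, h⟩ := hcauchy R hR (ε / 2) (by positivity)
    refine ⟨Metric.ball 0 R, mem_nhdsWithin_of_mem_nhds
      (Metric.isOpen_ball.mem_nhds (by simpa using hxR)), ?_⟩
    filter_upwards [Filter.eventually_ge_atTop n₀] with n hn y hy
    rw [mem_ball_zero_iff] at hy
    set z : 𝔻 := UnitDisc.mk y (hy.trans hR) with hz
    have hzy : (z : ℂ) = y := UnitDisc.coe_mk ..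
    rw [← hzy, ← hFG, ← hvu]
    refine lt_of_le_of_lt ?_ (half_lt_self hε)
    refine le_of_tendsto ((hG z).dist tendsto_const_nhds) ?_
    filter_upwards [Filter.eventually_ge_atTop n₀] with m hm
    exact (h m hm n hn z (by rw [hzy]; exact hy.le)).le
  have hFd : DifferentiableOn ℂ F (Metric.ball 0 1) :=
    hunif.differentiableOn (Filter.Eventually.of_forall hv) Metric.isOpen_ball
  set g : Hol := ⟨G, F, hFd, hFG⟩ with hg
  refine ⟨g, ENNReal.tendsto_nhds_zero.2 fun ε hε => ?_⟩
  obtain ⟨n₀, h⟩ := hu ε hε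
  filter_upwards [Filter.eventually_ge_atTop n₀] with n hn
  change hardyNorm p (u n - g) ≤ ε
  rw [hardyNorm_le_iff hp]
  intro r
  -- Fatou's lemma on the circle of radius `r`.
  have hlim : ∀ t, ‖((u n - g : Hol) : 𝔻 → ℂ) (circlePoint r t)‖ₑ ^ p = Filter.liminf
      (fun m => ‖((u n - u m : Hol) : 𝔻 → ℂ) (circlePoint r t)‖ₑ ^ p) Filter.atTop := fun t =>
    (((ENNReal.continuous_rpow_const.tendsto _).comp
      ((tendsto_const_nhds.sub (hG (circlePoint r t))).enorm)).liminf_eq).symm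
  rw [circleMean_eq_lintegral]
  simp only [hlim]
  refine (lintegral_liminf_le fun m =>
    ((continuous_comp_circlePoint (u n - u m) r).measurable.enorm).pow_const p).trans ?_
  refine Filter.liminf_le_of_frequently_le' (Filter.Eventually.frequently ?_)
  filter_upwards [Filter.eventually_ge_atTop n₀] with m hm
  rw [← circleMean_eq_lintegral]
  exact (hardyNorm_le_iff hp _ ε).1 (h n hn m hm).le r

theorem corollary4 (p₀ p₁ : ℝ) (hp₀ : 0 < p₀) (hp₁ : 0 < p₁)
    (T : ↥((hardy p₀ hp₀).space ⊔ (hardy p₁ hp₁).space) →ₗ[ℂ]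
      ↥((hardy p₀ hp₀).space ⊔ (hardy p₁ hp₁).space))
    (hT₀ : (hardy p₀ hp₀).IsBoundedOn T le_sup_left)
    (hT₁ : (hardy p₁ hp₁).IsBoundedOn T le_sup_right)
    (hT₁_compact : (hardy p₁ hp₁).IsCompactOn T le_sup_right)
    (θ : ℝ) (hθ₀ : 0 < θ) (hθ₁ : θ < 1) (q : ℝ≥0∞) (hq : 0 < q) :
    (ExtQuasiNorm.interp (hardy p₀ hp₀) (hardy p₁ hp₁) θ q hq).IsCompactOn T
      (ExtQuasiNorm.interp_space_le (hardy p₀ hp₀) (hardy p₁ hp₁) θ q hq) :=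
  ExtQuasiNorm.isCompactOn_interp (isSeqComplete_hardy hp₀) (isSeqComplete_hardy hp₁)
    (isSeparatedCouple_hardy hp₀ hp₁) T hT₀ hT₁ hT₁_compact hθ₀ hθ₁ hq
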